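/- A Boolean relation $R\subseteq\{0,1\}^r$ is an OR-conj (respectively NAND-conj) relation if it is defined by a conjunction of pins ($x_i=0$ or $x_i=1$) and ORs (respectively NANDs) of variables, of any arity. Such a formula is normalized if no pinned variable occurs in an OR (NAND), the arguments of each OR (NAND) are distinct, each OR (NAND) has at least two arguments, and the argument set of no OR (NAND) is contained in that of another; a formula that pins some variable to both values is moreover required to contain no OR (NAND), so that the empty relation has width $0$. The width of $R$ is the largest number of arguments of an OR (NAND) in a normalized formula defining $R$, and $0$ if there are none. A hypergraph $H=(V,E)$ has a finite vertex set $V$ and a set $E$ of non-empty subsets of $V$; its width is $\max_{e\in E}|e|$ ($0$ if $E=\emptyset$), its degree is the largest number of hyper-edges containing a common vertex, and $S\subseteq V$ is independent if $e\not\subseteq S$ for all $e\in E$. Let $\#w\text{-HIS}_d$ be the problem of counting the independent sets of a given hypergraph of width $w$ and degree at most $d$. For a finite set $\Gamma$ of named Boolean relations, an instance of $\#\mathrm{CSP}_d(\Gamma)$ is a finite set $V$ of variables and a set of constraints $Q(v_1,\dots,v_k)$ with $Q\in\Gamma$ of arity $k$ and $v_1,\dots,v_k\in V$ (not necessarily distinct),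 such that every variable appears at most $d$ times, counted with multiplicity, among the constraints; the task is to count the assignments $\sigma\colon V\to\{0,1\}$ that satisfy all constraints. Let $R_{\mathrm{zero}}=\{0\}$ and $R_{\mathrm{one}}=\{1\}$ be the two singleton unary relations. A randomized approximation scheme for a counting problem $f$ takes an instance $x$ of $f$ and an error bound $\epsilon\in(0,1)$ (given by a finite binary expansion) and produces a random natural number $Y$ with $\Pr\bigl(e^{-\epsilon}f(x)\le Y\le e^{\epsilon}f(x)\bigr)\ge\frac34$. An approximation-preserving (AP) reduction from $f$ to $g$ is a probabilistic oracle Turing machine $M$ that takes such pairs $(x,\epsilon)$ as input and satisfies: (i) every oracle call made by $M$ is of the form $(y,\delta)$, where $y$ is an instance of $g$ and $0<\delta<1$ satisfies $\delta^{-1}\le\mathrm{poly}(|x|,\epsilon^{-1})$; (ii) $M$ is a randomized approximation scheme for $f$ whenever the oracle is a randomized approximation scheme for $g$; (iii) the running time of $M$ is polynomial in $|x|$ and $\epsilon^{-1}$. **Proposition.** Let $R$ be an OR-conj or NAND-conj relation of width $w$, and let $d\ge 2$. Then there is an AP-reduction from $\#w\text{-HIS}_d$ to $\#\mathrm{CSP}_d(\{R\}\cup\{R_{\mathrm{zero}},R_{\mathrm{one}}\})$.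 -/

import Mathlib

/-! ### Boolean relations, OR-conj and NAND-conj relations, width -/

/-- A Boolean relation `R ⊆ {0,1}^r`. -/
structure BoolRel where
  arity : ℕ
  rel : Set (Fin arity → Bool)

/-- The unary relation `{0}`. -/
def BoolRel.zero : BoolRel := ⟨1, {a | a 0 = false}⟩

/-- The unary relation `{1}`. -/
def BoolRel.one : BoolRel := ⟨1, {a | a 0 = true}⟩

/-- A conjunction of pins `x_i = c` and of clauses over variables `x_0, …, x_{r-1}`; a clause is
the list of its arguments. The same syntax serves for ORs and for NANDs. -/
structure ConjFormula (r : ℕ) where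
  pins : List (Fin r × Bool)
  clauses : List (List (Fin r))

namespace ConjFormula

variable {r : ℕ}

/-- Truth of the formula when every clause is read as an OR of its arguments. -/
def HoldsOR (φ : ConjFormula r) (a : Fin r → Bool) : Prop :=
  (∀ p ∈ φ.pins, a p.1 = p.2) ∧ ∀ c ∈ φ.clauses, ∃ i ∈ c, a i = true

/-- Truth of the formula when every clause is read as a NAND of its arguments. -/
def HoldsNAND (φ : ConjFormula r) (a : Fin r → Bool) : Prop :=
  (∀ p ∈ φ.pins, a p.1 = p.2) ∧ ∀ c ∈ φ.clauses, ¬ ∀ i ∈ c, a i = true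

/-- Normalized formulae. The last field only concerns the empty relation: a formula that pins some
variable to both values has no clauses. (Without it the normalized formula, and hence the width, of
the empty relation would be ambiguous.) -/
structure Normalized (φ : ConjFormula r) : Prop where
  pinned_not_mem : ∀ p ∈ φ.pins, ∀ c ∈ φ.clauses, p.1 ∉ c
  nodup : ∀ c ∈ φ.clauses, c.Nodup
  two_le_length : ∀ c ∈ φ.clauses, 2 ≤ c.length
  incomparable : φ.clauses.Pairwise fun c c' => ¬ c ⊆ c' ∧ ¬ c' ⊆ c
  consistent : (∃ i, (i, false) ∈ φ.pins ∧ (i, true) ∈ φ.pins) → φ.clauses = []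

/-- The greatest number of arguments of a clause (`0` if there are no clauses). -/
def width (φ : ConjFormula r) : ℕ := (φ.clauses.map List.length).foldr max 0

end ConjFormula

/-- `R` is an OR-conj relation of width `w`. -/
def BoolRel.IsORConjOfWidth (R : BoolRel) (w : ℕ) : Prop :=
  ∃ φ : ConjFormula R.arity, φ.Normalized ∧ (∀ a, a ∈ R.rel ↔ φ.HoldsOR a) ∧ φ.width = w

/-- `R` is a NAND-conj relation of width `w`. -/
def BoolRel.IsNANDConjOfWidth (R : BoolRel) (w : ℕ) : Prop :=
  ∃ φ : ConjFormula R.arity, φ.Normalized ∧ (∀ a, a ∈ R.rel ↔ φ.HoldsNAND a) ∧ φ.width = w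

/-! ### Hypergraphs -/

/-- A finite hypergraph with vertex set all of `V`: a set of non-empty hyper-edges. -/
@[ext]
structure FinHypergraph (V : Type) where
  edges : Finset (Finset V)
  nonempty : ∀ e ∈ edges, e.Nonempty

namespace FinHypergraph

variable {V : Type} [Fintype V] [DecidableEq V]

/-- The number of hyper-edges containing `v`. -/
def vertexDegree (H : FinHypergraph V) (v : V) : ℕ := (H.edges.filter fun e => v ∈ e).card

/-- The maximum degree of a vertex. -/
def degree (H : FinHypergraph V) : ℕ := Finset.univ.sup H.vertexDegree

/-- The size of a largest hyper-edge. -/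
def width {V : Type} (H : FinHypergraph V) : ℕ := H.edges.sup Finset.card

/-- `S` contains no hyper-edge. -/
def IsIndependent {V : Type} (H : FinHypergraph V) (S : Finset V) : Prop :=
  ∀ e ∈ H.edges, ¬ e ⊆ S

end FinHypergraph

/-! ### Boolean constraint satisfaction -/

/-- A finite constraint language, i.e. relations named `0, …, m - 1`. -/
abbrev ConstraintLanguage := List BoolRel

/-- The language of the two pins. -/
def pinLanguage : ConstraintLanguage := [BoolRel.zero, BoolRel.one]

/-- The constraints `R(v̄)` over `Γ` with variables in `V`. -/
abbrev Constraint (Γ : ConstraintLanguage) (V : Type) : Type :=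
  Σ i : Fin Γ.length, (Fin (Γ.get i).arity → V)

/-- A CSP instance over `Γ` with variable set `V`: a set of constraints. -/
@[ext]
structure CSPInstance (Γ : ConstraintLanguage) (V : Type) where
  constraints : Finset (Constraint Γ V)

namespace CSPInstance

variable {Γ : ConstraintLanguage} {V : Type}

/-- The assignment `σ` satisfies every constraint. -/
def Satisfies (I : CSPInstance Γ V) (σ : V → Bool) : Prop :=
  ∀ c ∈ I.constraints, (fun j => σ (c.2 j)) ∈ (Γ.get c.1).rel

/-- The number of times that `v` appears among the constraints, with multiplicity in scopes. -/
def occurrences [DecidableEq V] (I : CSPInstance Γ V) (v : V) : ℕ :=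
  ∑ c ∈ I.constraints, (Finset.univ.filter fun j => c.2 j = v).card

/-- The greatest number of times that any variable appears. -/
def degree [Fintype V] [DecidableEq V] (I : CSPInstance Γ V) : ℕ :=
  Finset.univ.sup I.occurrences

end CSPInstance

/-! ### Counting problems over binary strings -/

/-- A counting problem: a class of instances, the binary strings that encode each of them
(an instance may have several encodings, a string encodes at most one instance), and the number to
be computed. Strings that encode no instance are not inputs of the problem. -/
structure CountingProblem where
  Inst : Type
  Encodes : List Bool → Inst → Prop
  encodes_unique : ∀ s I J, Encodes s I → Encodes s J → I = J
  exists_encoding : ∀ I, ∃ s, Encodes s I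
  count : Inst → ℕ

/-- The number `k` in unary, `1^k 0`. -/
def unary (k : ℕ) : List Bool := List.replicate k true ++ [false]

theorem unary_append_inj : ∀ {a b : ℕ} {u v : List Bool},
    unary a ++ u = unary b ++ v → a = b ∧ u = v
  | 0, 0, u, v, h => by simpa [unary] using h
  | 0, b + 1, u, v, h => by simp [unary, List.replicate_succ] at h
  | a + 1, 0, u, v, h => by simp [unary, List.replicate_succ] at h
  | a + 1, b + 1, u, v, h => by
    have h' : unary a ++ u = unary b ++ v := by
      simpa [unary, List.replicate_succ] using h
    obtain ⟨h1, h2⟩ := unary_append_inj h'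
    exact ⟨by omega, h2⟩

theorem flatMap_inj {α : Type} (c : α → List Bool) (hne : ∀ a, c a ≠ [])
    (hc : ∀ a b u v, c a ++ u = c b ++ v → a = b ∧ u = v) :
    ∀ L M : List α, L.flatMap c = M.flatMap c → L = M
  | [], [], _ => rfl
  | [], b :: M, h => by simp [hne] at h
  | a :: L, [], h => by simp [hne] at h
  | a :: L, b :: M, h => by
    simp only [List.flatMap_cons] at h
    obtain ⟨h1, h2⟩ := hc _ _ _ _ h
    rw [h1, flatMap_inj c hne hc L M h2]

/-- A hyper-edge as a row of the incidence matrix, preceded by a `1`. -/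
def edgeCode {n : ℕ} (e : Finset (Fin n)) : List Bool :=
  true :: List.ofFn fun i : Fin n => decide (i ∈ e)

/-- The number of vertices in unary, followed by the listed hyper-edges. -/
def hypergraphCode (n : ℕ) (L : List (Finset (Fin n))) : List Bool :=
  unary n ++ L.flatMap edgeCode

theorem edgeCode_append_inj {n : ℕ} (e f : Finset (Fin n)) (u v : List Bool)
    (h : edgeCode e ++ u = edgeCode f ++ v) : e = f ∧ u = v := by
  obtain ⟨h1, h2⟩ := List.append_inj h (by simp [edgeCode])
  refine ⟨?_, h2⟩
  have h3 := List.ofFn_injective (List.cons.inj h1).2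
  ext i
  have := congrFun h3 i
  simpa using this

/-- The string `s` encodes `H`: it lists the hyper-edges of `H`, in any order and each once. -/
def FinHypergraph.EncodedBy (s : List Bool) {n : ℕ} (H : FinHypergraph (Fin n)) : Prop :=
  ∃ L : List (Finset (Fin n)), L.Nodup ∧ L.toFinset = H.edges ∧ s = hypergraphCode n L

/-- Counting the independent sets of hypergraphs of width `w` and degree at most `d`. -/
noncomputable def countHIS (w d : ℕ) : CountingProblem where
  Inst := {H : Σ n : ℕ, FinHypergraph (Fin n) // H.2.width = w ∧ H.2.degree ≤ d}
  Encodes s H := FinHypergraph.EncodedBy s H.1.2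
  encodes_unique := by
    rintro s ⟨⟨n, H⟩, hH⟩ ⟨⟨m, K⟩, hK⟩ ⟨L, -, hL, hs⟩ ⟨M, -, hM, hs'⟩
    obtain ⟨rfl, h⟩ := unary_append_inj (hs.symm.trans hs')
    have := flatMap_inj edgeCode (by simp [edgeCode]) edgeCode_append_inj L M h
    subst this
    have : H = K := FinHypergraph.ext (hL.symm.trans hM)
    subst this
    rfl
  exists_encoding H :=
    ⟨_, H.1.2.edges.toList, Finset.nodup_toList _, Finset.toList_toFinset _, rfl⟩
  count H := Nat.card {S : Finset (Fin H.1.1) // H.1.2.IsIndependent S}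

/-- A constraint: the name of the relation, then the variables of the scope, in unary. -/
def constraintCode {Γ : ConstraintLanguage} {n : ℕ} (c : Constraint Γ (Fin n)) : List Bool :=
  unary c.1 ++ (List.ofFn fun j => (c.2 j : ℕ)).flatMap unary

/-- The number of variables in unary, followed by the listed constraints. -/
def cspCode {Γ : ConstraintLanguage} (n : ℕ) (L : List (Constraint Γ (Fin n))) : List Bool :=
  unary n ++ L.flatMap constraintCode

theorem unary_ne_nil (k : ℕ) : unary k ≠ [] := by simp [unary]

theorem flatMap_unary_append_inj : ∀ (L M : List ℕ) (u v : List Bool), L.length = M.length →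
    L.flatMap unary ++ u = M.flatMap unary ++ v → L = M ∧ u = v
  | [], [], u, v, _, h => by simpa using h
  | [], b :: M, u, v, h, _ => by simp at h
  | a :: L, [], u, v, h, _ => by simp at h
  | a :: L, b :: M, u, v, hl, h => by
    simp only [List.flatMap_cons, List.append_assoc] at h
    obtain ⟨h1, h2⟩ := unary_append_inj h
    obtain ⟨h3, h4⟩ := flatMap_unary_append_inj L M u v (by simpa using hl) h2
    exact ⟨by rw [h1, h3], h4⟩

theorem constraintCode_append_inj {Γ : ConstraintLanguage} {n : ℕ}
    (c c' : Constraint Γ (Fin n)) (u v : List Bool)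
    (h : constraintCode c ++ u = constraintCode c' ++ v) : c = c' ∧ u = v := by
  obtain ⟨i, x⟩ := c
  obtain ⟨j, y⟩ := c'
  simp only [constraintCode, List.append_assoc] at h
  obtain ⟨h1, h2⟩ := unary_append_inj h
  obtain rfl : i = j := Fin.ext h1
  obtain ⟨h3, h4⟩ := flatMap_unary_append_inj _ _ _ _ (by simp) h2
  have h5 := List.ofFn_injective h3
  have : x = y := funext fun k => Fin.ext (congrFun h5 k)
  exact ⟨by rw [this], h4⟩

/-- The string `s` encodes `I`: it lists the constraints of `I`, in any order and each once. -/
def CSPInstance.EncodedBy {Γ : ConstraintLanguage} (s : List Bool) {n : ℕ}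
    (I : CSPInstance Γ (Fin n)) : Prop :=
  ∃ L : List (Constraint Γ (Fin n)), L.Nodup ∧ L.toFinset = I.constraints ∧ s = cspCode n L

/-- Counting the satisfying assignments of CSP instances over `Γ` of degree at most `d`. -/
noncomputable def countCSP (d : ℕ) (Γ : ConstraintLanguage) : CountingProblem where
  Inst := {I : Σ n : ℕ, CSPInstance Γ (Fin n) // I.2.degree ≤ d}
  Encodes s I := CSPInstance.EncodedBy s I.1.2
  encodes_unique := by
    rintro s ⟨⟨n, H⟩, hH⟩ ⟨⟨m, K⟩, hK⟩ ⟨L, -, hL, hs⟩ ⟨M, -, hM, hs'⟩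
    obtain ⟨rfl, h⟩ := unary_append_inj (hs.symm.trans hs')
    have := flatMap_inj constraintCode (by simp [constraintCode, unary_ne_nil])
      constraintCode_append_inj L M h
    subst this
    have : H = K := CSPInstance.ext (hL.symm.trans hM)
    subst this
    rfl
  exists_encoding I :=
    ⟨_, I.1.2.constraints.toList, Finset.nodup_toList _, Finset.toList_toFinset _, rfl⟩
  count I := Nat.card {σ : Fin I.1.1 → Bool // I.1.2.Satisfies σ}

/-! ### Randomized approximation schemes -/

noncomputable section

/-- An error bound is given by a finite binary expansion: `b₁ b₂ … bₘ` stands for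
`0.b₁b₂…bₘ`, a number in `[0, 1)`. -/
def errorValue : List Bool → ℝ
  | [] => 0
  | b :: l => ((b.toNat : ℝ) + errorValue l) / 2

/-- The number written in binary, least significant bit first. -/
def binaryValue (s : List Bool) : ℕ := Nat.ofDigits 2 (s.map Bool.toNat)

/-- With probability at least `3/4`, the random output `Y` (written in binary) satisfies
`e^{-ε} ≤ Y / v ≤ e^ε`, where for `v = 0` this means `Y = 0`. -/
def Approximates (μ : PMF (List Bool)) (ε : ℝ) (v : ℕ) : Prop :=
  3 / 4 ≤ μ.toOuterMeasure {s | Real.exp (-ε) * v ≤ binaryValue s ∧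
    (binaryValue s : ℝ) ≤ Real.exp ε * v}

/-- A randomized procedure mapping a pair of strings `(x, ε)` to a random output string, each call
with fresh randomness. -/
abbrev RandomizedMap := List Bool → List Bool → PMF (List Bool)

/-- `A` is a randomized approximation scheme for `f`. -/
def IsRAS (A : RandomizedMap) (f : CountingProblem) : Prop :=
  ∀ x I, f.Encodes x I → ∀ e, errorValue e ∈ Set.Ioo (0 : ℝ) 1 →
    Approximates (A x e) (errorValue e) (f.count I)

/-! ### Probabilistic oracle Turing machines -/

/-- The nonblank symbols in a half-tape; `none` is the blank. -/
def halfTapeString (l : Turing.ListBlank (Option Bool)) : List Bool :=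
  l.liftOn List.reduceOption (by
    rintro a b ⟨n, rfl⟩
    have : List.reduceOption (List.replicate n (none : Option Bool)) = [] := by
      simp [List.reduceOption]
    change a.reduceOption = (a ++ List.replicate n none).reduceOption
    rw [List.reduceOption_append, this, List.append_nil])

/-- The string written on a tape: its nonblank symbols from left to right. -/
def tapeString (T : Turing.Tape (Option Bool)) : List Bool :=
  (halfTapeString T.left).reverse ++ halfTapeString T.right₀

/-- A probabilistic oracle Turing machine with `k` two-way infinite tapes over the symbols
`0`, `1` and blank and with finitely many states. In each ordinary step it tosses a fair coin;
depending on the state, the scanned symbols and the coin, it changes its state, writes a symbol on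
each tape and moves each head by at most one cell. In the state `query` it consults the oracle in
one step. Tapes may play several of the designated roles. -/
structure OracleMachine where
  k : ℕ
  State : Type
  [fintypeState : Fintype State]
  [decEqState : DecidableEq State]
  start : State
  halt : State
  query : State
  resume : State
  inputTape : Fin k
  errorTape : Fin k
  input_ne_error : inputTape ≠ errorTape
  queryTape : Fin k
  queryErrorTape : Fin k
  query_ne_queryError : queryTape ≠ queryErrorTape
  answerTape : Fin k
  outputTape : Fin k
  step : State → (Fin k → Option Bool) → Bool →
    State × (Fin k → Option Bool × Option Turing.Dir)

attribute [instance] OracleMachine.fintypeState OracleMachine.decEqState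

namespace OracleMachine

/-- A configuration: the state and the tapes with their head positions. -/
structure Cfg (M : OracleMachine) where
  state : M.State
  tape : Fin M.k → Turing.Tape (Option Bool)

/-- Move the head by one cell, or not at all. -/
def moveHead : Option Turing.Dir → Turing.Tape (Option Bool) → Turing.Tape (Option Bool)
  | none, T => T
  | some D, T => T.move D

/-- A tape with the string `s`, scanned at its first symbol. -/
def stringTape (s : List Bool) : Turing.Tape (Option Bool) := Turing.Tape.mk₁ (s.map some)

variable (M : OracleMachine)

/-- The configuration at the start, on input `(x, ε)`. -/
def init (x e : List Bool) : M.Cfg where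
  state := M.start
  tape i := if i = M.inputTape then stringTape x
    else if i = M.errorTape then stringTape e else stringTape []

/-- The result of an ordinary step with coin `b`. -/
def stepWith (c : M.Cfg) (b : Bool) : M.Cfg :=
  let r := M.step c.state (fun i => (c.tape i).head) b
  ⟨r.1, fun i => moveHead (r.2 i).2 ((c.tape i).write (r.2 i).1)⟩

/-- The result of an oracle call that returned the string `s`. -/
def answerWith (c : M.Cfg) (s : List Bool) : M.Cfg :=
  ⟨M.resume, Function.update c.tape M.answerTape (stringTape s)⟩

/-- The string and the error bound of an oracle call made in configuration `c`. -/
def queryString (c : M.Cfg) : List Bool := tapeString (c.tape M.queryTape)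

/-- See `queryString`. -/
def queryError (c : M.Cfg) : List Bool := tapeString (c.tape M.queryErrorTape)

/-- The distribution of the next configuration. -/
def next (O : RandomizedMap) (c : M.Cfg) : PMF M.Cfg :=
  if c.state = M.halt then PMF.pure c
  else if c.state = M.query then (O (M.queryString c) (M.queryError c)).map (M.answerWith c)
  else (PMF.uniformOfFintype Bool).map (M.stepWith c)

/-- The distribution of the configuration after `t` steps, on input `(x, ε)`. -/
def run (O : RandomizedMap) (x e : List Bool) : ℕ → PMF M.Cfg
  | 0 => PMF.pure (M.init x e)
  | t + 1 => (run O x e t).bind (M.next O)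

/-- The distribution of the string on the output tape after `t` steps. -/
def output (O : RandomizedMap) (x e : List Bool) (t : ℕ) : PMF (List Bool) :=
  (M.run O x e t).map fun c => tapeString (c.tape M.outputTape)

end OracleMachine

/-! ### Approximation-preserving reductions -/

/-- The value of a polynomial in `|x|` and `ε⁻¹`. -/
def polyBound (p : MvPolynomial (Fin 2) ℕ) (x e : List Bool) : ℝ :=
  MvPolynomial.aeval ![(x.length : ℝ), (errorValue e)⁻¹] p

/-- `M` is an approximation-preserving reduction from `f` to `g`. -/
structure IsAPReduction (M : OracleMachine) (f g : CountingProblem) : Prop where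
  /-- Whatever the oracle answers, each oracle call is an instance of `g` with an error bound `δ`
  for which `δ⁻¹` is polynomially bounded. -/
  calls : ∃ p : MvPolynomial (Fin 2) ℕ, ∀ x I, f.Encodes x I →
    ∀ e, errorValue e ∈ Set.Ioo (0 : ℝ) 1 → ∀ (O : RandomizedMap) (t : ℕ),
    ∀ c ∈ (M.run O x e t).support, c.state = M.query →
      (∃ J, g.Encodes (M.queryString c) J) ∧
      errorValue (M.queryError c) ∈ Set.Ioo (0 : ℝ) 1 ∧
      (errorValue (M.queryError c))⁻¹ ≤ polyBound p x e
  /-- Whatever the coins and the oracle's answers, `M` halts in polynomial time; and the output on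
  halting is a randomized approximation scheme for `f` if the oracle is one for `g`. -/
  halts_and_approximates : ∃ p : MvPolynomial (Fin 2) ℕ,
    (∀ x I, f.Encodes x I → ∀ e, errorValue e ∈ Set.Ioo (0 : ℝ) 1 →
      ∀ (O : RandomizedMap) (t : ℕ), polyBound p x e ≤ t →
      ∀ c ∈ (M.run O x e t).support, c.state = M.halt) ∧
    ∀ O : RandomizedMap, IsRAS O g → IsRAS (fun x e => M.output O x e ⌈polyBound p x e⌉₊) f

/-- `f` is AP-reducible to `g`. -/
def APReducible (f g : CountingProblem) : Prop :=
  ∃ M : OracleMachine, IsAPReduction M f g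

end

/-! The heart is a gadget. Take a normalized formula for `R`, and let `b` be the value that
satisfies its clauses: `true` for ORs, `false` for NANDs. Fix a clause `c` with `w` arguments and
pin every argument outside `c`: as the formula demands if it pins that argument, and to `b`
otherwise. Any other clause is not contained in `c`, so it has an argument outside `c`; the formula
does not pin this argument, so it received `b` and the clause holds. All that is left of `R` is `c`
(`ConjFormula.Normalized.forall_iff`, `exists_isGadget`).

Each hyper-edge `e` becomes one copy of `R`, with the vertices of `e` in arguments of `c` and pinned
fresh variables everywhere else. A fresh variable in a spare argument of `c` is pinned to `!b`, so
it cannot satisfy `c`, and the constraint says that some vertex of `e` has value `b`. Reading the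
vertices of value `!b` as a set, solutions correspond bijectively to independent sets
(`card_satisfies_gadgetInstance`). A vertex occurs once for each hyper-edge containing it; a fresh
variable occurs at most twice, which is where `2 ≤ d` enters (`gadgetInstance_degree_le`). In width
`0` there are no hyper-edges, since hyper-edges are non-empty, and no gadget is needed.

As the counts agree exactly, a single oracle call with the given error bound, whose answer is
returned unchanged, is an AP-reduction once the query can be written in polynomial time
(`apReducible_of_computes`). The machine is assembled from structured programs with explicit time
bounds (`TapeProgram.computes_reduction`). The query is written from right to left, as a stack, so
the number of variables can be pushed last, when it is known. Every hyper-edge uses up as many fresh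
variables as `R` has arguments, needed or not; one unary counter then names them all, and pinning
the superfluous ones keeps the count unchanged. -/

/-! ### Structured tape programs -/

/-- What is done to a single tape in one step, depending on the scanned symbol. -/
abbrev TapeOp := Option Bool → Option Bool × Option Turing.Dir

namespace TapeOp

/-- Leave the tape alone. -/
def keep : TapeOp := fun a => (a, none)

/-- Move the head. -/
def shift (D : Turing.Dir) : TapeOp := fun a => (a, some D)

/-- Write a symbol, then move the head. -/
def put (b : Option Bool) (D : Turing.Dir) : TapeOp := fun _ => (b, some D)

/-- Erase the scanned symbol. -/
def erase : TapeOp := fun _ => (none, none)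

/-- The effect of an operation on a tape. -/
def apply (o : TapeOp) (T : Turing.Tape (Option Bool)) : Turing.Tape (Option Bool) :=
  OracleMachine.moveHead (o T.head).2 (T.write (o T.head).1)

@[simp] theorem apply_keep (T : Turing.Tape (Option Bool)) : keep.apply T = T :=
  Turing.Tape.write_self T

@[simp] theorem apply_shift (D : Turing.Dir) (T : Turing.Tape (Option Bool)) :
    (shift D).apply T = T.move D :=
  congrArg (Turing.Tape.move D) (Turing.Tape.write_self T)

@[simp] theorem apply_put (b : Option Bool) (D : Turing.Dir) (T : Turing.Tape (Option Bool)) :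
    (put b D).apply T = (T.write b).move D := rfl

@[simp] theorem apply_erase (T : Turing.Tape (Option Bool)) : erase.apply T = T.write none := rfl

end TapeOp

/-- Deterministic structured programs acting on `k` tapes; tests depend on the scanned symbols. -/
inductive TapeProgram (k : ℕ) : Type
  | act (o : Fin k → TapeOp)
  | seq (p q : TapeProgram k)
  | loop (c : (Fin k → Option Bool) → Bool) (p : TapeProgram k)
  | ite (c : (Fin k → Option Bool) → Bool) (p q : TapeProgram k)

namespace TapeProgram

variable {k : ℕ}

/-- The contents of `k` tapes. -/
abbrev Tapes (k : ℕ) := Fin k → Turing.Tape (Option Bool)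

/-- The scanned symbols. -/
def heads (T : Tapes k) : Fin k → Option Bool := fun i => (T i).head

/-- Write and move on every tape. -/
def perform (a : Fin k → Option Bool × Option Turing.Dir) (T : Tapes k) : Tapes k :=
  fun i => OracleMachine.moveHead (a i).2 ((T i).write (a i).1)

/-- The control positions of a program. -/
def Pos : TapeProgram k → Type
  | act _ => Unit
  | seq p q => p.Pos ⊕ q.Pos
  | loop _ p => Option p.Pos
  | ite _ p q => Option (p.Pos ⊕ q.Pos)

instance fintypePos : (p : TapeProgram k) → Fintype p.Pos
  | act _ => inferInstanceAs (Fintype Unit)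
  | seq p q =>
    letI := fintypePos p
    letI := fintypePos q
    inferInstanceAs (Fintype (p.Pos ⊕ q.Pos))
  | loop _ p =>
    letI := fintypePos p
    inferInstanceAs (Fintype (Option p.Pos))
  | ite _ p q =>
    letI := fintypePos p
    letI := fintypePos q
    inferInstanceAs (Fintype (Option (p.Pos ⊕ q.Pos)))

/-- The control position at the start. -/
def entry : (p : TapeProgram k) → p.Pos
  | act _ => ()
  | seq p _ => Sum.inl p.entry
  | loop _ _ => (none : Option _)
  | ite _ _ _ => (none : Option _)

/-- One step: the next position (`none` on leaving the program) and what to do to the tapes. -/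
def trans : (p : TapeProgram k) → p.Pos → (Fin k → Option Bool) →
    Option p.Pos × (Fin k → Option Bool × Option Turing.Dir)
  | act o, _, h => (none, fun i => o i (h i))
  | seq p q, Sum.inl s, h =>
    (some ((p.trans s h).1.elim (Sum.inr q.entry) Sum.inl), (p.trans s h).2)
  | seq _ q, Sum.inr s, h => ((q.trans s h).1.map Sum.inr, (q.trans s h).2)
  | loop c p, none, h => (if c h then some (some p.entry) else none, fun i => (h i, none))
  | loop _ p, some s, h => (some (p.trans s h).1, (p.trans s h).2)
  | ite c p q, none, h =>
    (some (some (if c h then Sum.inl p.entry else Sum.inr q.entry)), fun i => (h i, none))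
  | ite _ p _, some (Sum.inl s), h =>
    ((p.trans s h).1.map fun s => some (Sum.inl s), (p.trans s h).2)
  | ite _ _ q, some (Sum.inr s), h =>
    ((q.trans s h).1.map fun s => some (Sum.inr s), (q.trans s h).2)

/-- Started at position `s` with tapes `T`, the program is left after exactly `t` steps with
tapes `U`. -/
inductive Runs (p : TapeProgram k) : p.Pos → Tapes k → ℕ → Tapes k → Prop
  | exit {s : p.Pos} {T U : Tapes k} (h : (p.trans s (heads T)).1 = none)
      (hT : perform (p.trans s (heads T)).2 T = U) : Runs p s T 1 U
  | step {s s' : p.Pos} {T T₁ U : Tapes k} {t : ℕ} (h : (p.trans s (heads T)).1 = some s')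
      (hT : perform (p.trans s (heads T)).2 T = T₁) (hr : Runs p s' T₁ t U) :
      Runs p s T (t + 1) U

/-- The program turns the tapes `T` into `T'` within `b` steps. -/
def Computes (p : TapeProgram k) (T : Tapes k) (b : ℕ) (T' : Tapes k) : Prop :=
  ∃ t ≤ b, p.Runs p.entry T t T'

theorem perform_stay (T : Tapes k) : perform (fun i => (heads T i, none)) T = T :=
  funext fun i => Turing.Tape.write_self (T i)

theorem Computes.mono {p : TapeProgram k} {T T' : Tapes k} {b b' : ℕ} (h : p.Computes T b T')
    (hb : b ≤ b') : p.Computes T b' T' :=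
  let ⟨t, ht, hr⟩ := h
  ⟨t, ht.trans hb, hr⟩

theorem computes_act (o : Fin k → TapeOp) (T : Tapes k) :
    (act o).Computes T 1 fun i => (o i).apply (T i) :=
  ⟨1, le_rfl, .exit rfl rfl⟩

theorem Runs.seq_right (p : TapeProgram k) {q : TapeProgram k} {s : q.Pos} {T T' : Tapes k}
    {t : ℕ} (h : q.Runs s T t T') : (seq p q).Runs (Sum.inr s) T t T' := by
  induction h with
  | exit h hT => exact .exit (by simp only [trans, h]; rfl) hT
  | step h hT _ ih => exact .step (by simp only [trans, h]; rfl) hT ih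

/-- The step that leaves `p` is the one that enters `q`, so durations add exactly. The sum is
written `t' + t` so that lengthening the run of `p` is definitionally a successor. -/
theorem Runs.seq {p q : TapeProgram k} {s : p.Pos} {T T₁ T' : Tapes k} {t t' : ℕ}
    (h : p.Runs s T t T₁) (h' : q.Runs q.entry T₁ t' T') :
    (seq p q).Runs (Sum.inl s) T (t' + t) T' := by
  induction h with
  | exit h hT => exact .step (by simp only [trans, h]; rfl) hT (h'.seq_right _)
  | step h hT _ ih => exact .step (by simp only [trans, h]; rfl) hT (ih h')

theorem Computes.seq {p q : TapeProgram k} {T T₁ T' : Tapes k} {b b' : ℕ}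
    (h : p.Computes T b T₁) (h' : q.Computes T₁ b' T') :
    (seq p q).Computes T (b + b') T' := by
  obtain ⟨t, ht, hr⟩ := h
  obtain ⟨t', ht', hr'⟩ := h'
  exact ⟨t' + t, by omega, hr.seq hr'⟩

theorem computes_loop_of_false {c : (Fin k → Option Bool) → Bool} (p : TapeProgram k)
    {T : Tapes k} (hc : c (heads T) = false) : (loop c p).Computes T 1 T :=
  ⟨1, le_rfl, .exit (by simp [trans, entry, hc]) (perform_stay T)⟩

theorem Runs.loop {c : (Fin k → Option Bool) → Bool} {p : TapeProgram k} {s : p.Pos}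
    {T T₁ T' : Tapes k} {t t' : ℕ} (h : p.Runs s T t T₁)
    (h' : (loop c p).Runs (loop c p).entry T₁ t' T') :
    (loop c p).Runs (some s : Option p.Pos) T (t' + t) T' := by
  induction h with
  | exit h hT => exact .step (by simp only [trans, h]; rfl) hT h'
  | step h hT _ ih => exact .step (by simp only [trans, h]) hT (ih h')

/-- The extra step is the test, which rewrites the scanned symbols without moving. -/
theorem computes_loop_of_true {c : (Fin k → Option Bool) → Bool} {p : TapeProgram k}
    {T T₁ T' : Tapes k} {b b' : ℕ} (hc : c (heads T) = true) (h : p.Computes T b T₁)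
    (h' : (loop c p).Computes T₁ b' T') : (loop c p).Computes T (b + b' + 1) T' := by
  obtain ⟨t, ht, hr⟩ := h
  obtain ⟨t', ht', hr'⟩ := h'
  exact ⟨t' + t + 1, by omega,
    .step (by simp only [trans, entry, hc]; rfl) (perform_stay T) (hr.loop hr')⟩

theorem Runs.ite_left {c : (Fin k → Option Bool) → Bool} {p : TapeProgram k} (q : TapeProgram k)
    {s : p.Pos} {T T' : Tapes k} {t : ℕ} (h : p.Runs s T t T') :
    (ite c p q).Runs (some (Sum.inl s) : Option (p.Pos ⊕ q.Pos)) T t T' := by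
  induction h with
  | exit h hT => exact .exit (by simp only [trans, h]; rfl) hT
  | step h hT _ ih => exact .step (by simp only [trans, h]; rfl) hT ih

theorem Runs.ite_right {c : (Fin k → Option Bool) → Bool} (p : TapeProgram k) {q : TapeProgram k}
    {s : q.Pos} {T T' : Tapes k} {t : ℕ} (h : q.Runs s T t T') :
    (ite c p q).Runs (some (Sum.inr s) : Option (p.Pos ⊕ q.Pos)) T t T' := by
  induction h with
  | exit h hT => exact .exit (by simp only [trans, h]; rfl) hT
  | step h hT _ ih => exact .step (by simp only [trans, h]; rfl) hT ih

theorem computes_ite_of_true {c : (Fin k → Option Bool) → Bool} {p : TapeProgram k}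
    (q : TapeProgram k) {T T' : Tapes k} {b : ℕ} (hc : c (heads T) = true)
    (h : p.Computes T b T') : (ite c p q).Computes T (b + 1) T' := by
  obtain ⟨t, ht, hr⟩ := h
  exact ⟨t + 1, by omega,
    .step (by simp only [trans, entry, hc]; rfl) (perform_stay T) (hr.ite_left q)⟩

theorem computes_ite_of_false {c : (Fin k → Option Bool) → Bool} (p : TapeProgram k)
    {q : TapeProgram k} {T T' : Tapes k} {b : ℕ} (hc : c (heads T) = false)
    (h : q.Computes T b T') : (ite c p q).Computes T (b + 1) T' := by
  obtain ⟨t, ht, hr⟩ := h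
  exact ⟨t + 1, by omega,
    .step (by simp only [trans, entry, hc]; rfl) (perform_stay T) (hr.ite_right p)⟩

/-! ### Programs as oracle machines with a single call -/

/-- The machine that runs `p`, then makes an oracle call with the string on tape `2` and the
unchanged error bound on tape `1`, and returns the answer. -/
noncomputable def machine (p : TapeProgram 6) : OracleMachine where
  k := 6
  State := p.Pos ⊕ Bool
  decEqState := Classical.decEq _
  start := Sum.inl p.entry
  halt := Sum.inr true
  query := Sum.inr false
  resume := Sum.inr true
  inputTape := 0
  errorTape := 1
  input_ne_error := by decide
  queryTape := 2
  queryErrorTape := 1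
  query_ne_queryError := by decide
  answerTape := 3
  outputTape := 3
  step s h _ := match s with
    | Sum.inl s => ((p.trans s h).1.elim (Sum.inr false) Sum.inl, (p.trans s h).2)
    | Sum.inr b => (Sum.inr b, fun i => (h i, none))

/-- The tapes at the start. -/
def initTapes (x e : List Bool) : Tapes 6 := fun i =>
  if i = 0 then OracleMachine.stringTape x
    else if i = 1 then OracleMachine.stringTape e else OracleMachine.stringTape []

/-- The configuration of the machine at a given position. -/
noncomputable def cfg (p : TapeProgram 6) (s : p.Pos ⊕ Bool) (T : Tapes 6) : p.machine.Cfg :=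
  ⟨s, T⟩

/-- Both outcomes of the coin lead to the same configuration, so the next distribution is a point
mass. -/
theorem machine_next_pos (p : TapeProgram 6) (O : RandomizedMap) (s : p.Pos) (T : Tapes 6) :
    p.machine.next O (p.cfg (Sum.inl s) T) = PMF.pure
      (p.cfg ((p.trans s (heads T)).1.elim (Sum.inr false) Sum.inl)
        (perform (p.trans s (heads T)).2 T)) := by
  have h1 : (p.cfg (Sum.inl s) T).state ≠ p.machine.halt :=
    (Sum.inl_ne_inr : (Sum.inl s : p.Pos ⊕ Bool) ≠ Sum.inr true)
  have h2 : (p.cfg (Sum.inl s) T).state ≠ p.machine.query :=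
    (Sum.inl_ne_inr : (Sum.inl s : p.Pos ⊕ Bool) ≠ Sum.inr false)
  rw [OracleMachine.next, if_neg h1, if_neg h2]
  exact PMF.map_const (PMF.uniformOfFintype Bool)
    (p.cfg ((p.trans s (heads T)).1.elim (Sum.inr false) Sum.inl)
      (perform (p.trans s (heads T)).2 T))

theorem machine_next_query (p : TapeProgram 6) (O : RandomizedMap) (T : Tapes 6) :
    p.machine.next O (p.cfg (Sum.inr false) T) =
      (O (tapeString (T 2)) (tapeString (T 1))).map
        fun s => p.cfg (Sum.inr true) (Function.update T 3 (OracleMachine.stringTape s)) := by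
  have h1 : (p.cfg (Sum.inr false) T).state ≠ p.machine.halt := fun h =>
    Bool.false_ne_true (Sum.inr_injective (h : (Sum.inr false : p.Pos ⊕ Bool) = Sum.inr true))
  have h2 : (p.cfg (Sum.inr false) T).state = p.machine.query := rfl
  rw [OracleMachine.next, if_neg h1, if_pos h2]
  rfl

theorem machine_next_halt (p : TapeProgram 6) (O : RandomizedMap) (T : Tapes 6) :
    p.machine.next O (p.cfg (Sum.inr true) T) = PMF.pure (p.cfg (Sum.inr true) T) := by
  have h : (p.cfg (Sum.inr true) T).state = p.machine.halt := rfl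
  rw [OracleMachine.next, if_pos h]

/-- Consecutive configurations of the machine while it runs `p`. -/
theorem Runs.machine_run {p : TapeProgram 6} {O : RandomizedMap} {x e : List Bool} {s : p.Pos}
    {T T' : Tapes 6} {t : ℕ} (h : p.Runs s T t T') : ∀ t₀ : ℕ,
    p.machine.run O x e t₀ = PMF.pure (p.cfg (Sum.inl s) T) →
    (∀ u < t, ∃ s' T₁, p.machine.run O x e (t₀ + u) = PMF.pure (p.cfg (Sum.inl s') T₁)) ∧
      p.machine.run O x e (t₀ + t) = PMF.pure (p.cfg (Sum.inr false) T') := by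
  induction h with
  | @exit s T T' h hT =>
    intro t₀ h₀
    refine ⟨fun u hu => ⟨s, T, by rwa [Nat.lt_one_iff.1 hu]⟩, ?_⟩
    rw [OracleMachine.run, h₀, PMF.pure_bind, machine_next_pos, h, hT]
    rfl
  | @step s s' T T₁ T' t h hT _ ih =>
    intro t₀ h₀
    have h₁ : p.machine.run O x e (t₀ + 1) = PMF.pure (p.cfg (Sum.inl s') T₁) := by
      rw [OracleMachine.run, h₀, PMF.pure_bind, machine_next_pos, h, hT]
      rfl
    obtain ⟨ih₁, ih₂⟩ := ih (t₀ + 1) h₁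
    refine ⟨fun u hu => ?_, by rwa [add_right_comm, add_assoc] at ih₂⟩
    cases u with
    | zero => exact ⟨s, T, h₀⟩
    | succ u =>
      have := ih₁ u (by omega)
      rwa [add_right_comm, add_assoc] at this

theorem machine_run_init (p : TapeProgram 6) (O : RandomizedMap) (x e : List Bool) :
    p.machine.run O x e 0 = PMF.pure (p.cfg (Sum.inl p.entry) (initTapes x e)) := rfl

/-- After the oracle call the machine has halted with the answer on tape `3`. -/
theorem machine_run_halted {p : TapeProgram 6} {O : RandomizedMap} {x e : List Bool}
    {T : Tapes 6} {t : ℕ} (h : p.machine.run O x e t = PMF.pure (p.cfg (Sum.inr false) T))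
    (u : ℕ) :
    p.machine.run O x e (t + (u + 1)) = (O (tapeString (T 2)) (tapeString (T 1))).map
      fun s => p.cfg (Sum.inr true) (Function.update T 3 (OracleMachine.stringTape s)) := by
  induction u with
  | zero => rw [zero_add, OracleMachine.run, h, PMF.pure_bind, machine_next_query]
  | succ u ih =>
    rw [← add_assoc, OracleMachine.run, ih, PMF.bind_map]
    exact congrArg (PMF.bind _) (funext fun s => machine_next_halt p O _)

end TapeProgram

/-! ### Parsimonious reductions are approximation-preserving -/

theorem halfTapeString_mk_map_some (s : List Bool) :
    halfTapeString (Turing.ListBlank.mk (s.map some)) = s := by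
  change (s.map some).reduceOption = s
  induction s with
  | nil => rfl
  | cons b s ih => rw [List.map_cons, List.reduceOption_cons_of_some, ih]

theorem tapeString_stringTape (s : List Bool) :
    tapeString (OracleMachine.stringTape s) = s := by
  rw [tapeString, OracleMachine.stringTape, Turing.Tape.mk₁, Turing.Tape.mk₂,
    Turing.Tape.mk'_left, Turing.Tape.mk'_right₀, halfTapeString_mk_map_some]
  rfl

open TapeProgram in
/-- A parsimonious reduction that is computed by a tape program in polynomial time is an
AP-reduction. -/
theorem apReducible_of_computes {f g : CountingProblem} (p : TapeProgram 6) (P : Polynomial ℕ)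
    (h : ∀ x I, f.Encodes x I → ∃ y J, g.Encodes y J ∧ g.count J = f.count I ∧
      ∀ e, ∃ T, p.Computes (initTapes x e) (P.eval x.length) T ∧ tapeString (T 2) = y ∧
        tapeString (T 1) = e) :
    APReducible f g := by
  -- The time bound: the steps of the program plus one for the oracle call, independently of the
  -- error bound.
  have hP : ∀ x e : List Bool, polyBound (Polynomial.aeval (MvPolynomial.X 0) P + 1) x e =
      ((P.eval x.length + 1 : ℕ) : ℝ) := by
    intro x e
    rw [polyBound, map_add, map_one, ← Polynomial.aeval_algHom_apply]
    simp only [MvPolynomial.aeval_X, Matrix.cons_val_zero, Nat.cast_add, Nat.cast_one]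
    congr 1
    exact Polynomial.aeval_algebraMap_apply_eq_algebraMap_eval (A := ℝ) x.length P
  have hrun : ∀ x I, f.Encodes x I → ∃ y J, g.Encodes y J ∧ g.count J = f.count I ∧
      ∀ e O, ∃ (T : Tapes 6) (t : ℕ),
        t ≤ P.eval x.length ∧ tapeString (T 2) = y ∧ tapeString (T 1) = e ∧
        (∀ u < t, ∃ s' T₁, p.machine.run O x e u = PMF.pure (p.cfg (Sum.inl s') T₁)) ∧
        p.machine.run O x e t = PMF.pure (p.cfg (Sum.inr false) T) := by
    intro x I hI
    obtain ⟨y, J, hJ, hc, hy⟩ := h x I hI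
    refine ⟨y, J, hJ, hc, fun e O => ?_⟩
    obtain ⟨T, ⟨t, ht, hr⟩, h2, h1⟩ := hy e
    have := hr.machine_run (O := O) (x := x) (e := e) 0 (machine_run_init p O x e)
    simp only [zero_add] at this
    exact ⟨T, t, ht, h2, h1, this⟩
  -- The oracle is called with the error bound of the input, so its inverse is bounded by the second
  -- indeterminate itself.
  refine ⟨p.machine, ⟨⟨MvPolynomial.X 1, ?_⟩, ⟨Polynomial.aeval (MvPolynomial.X 0) P + 1, ?_, ?_⟩⟩⟩
  · intro x I hI e he O t c hc hq
    obtain ⟨y, J, hJ, -, hy⟩ := hrun x I hI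
    obtain ⟨T, t', -, h2, h1, hlt, heq⟩ := hy e O
    -- The machine is inside the program before time `t'`, makes its only query at time `t'`, and
    -- has halted afterwards.
    rcases lt_trichotomy t t' with htt | rfl | htt
    · obtain ⟨s', T₁, hs⟩ := hlt t htt
      rw [hs, PMF.support_pure, Set.mem_singleton_iff] at hc
      subst hc
      exact absurd hq (Sum.inl_ne_inr : (Sum.inl s' : p.Pos ⊕ Bool) ≠ Sum.inr false)
    · rw [heq, PMF.support_pure, Set.mem_singleton_iff] at hc
      subst hc
      have hq1 : p.machine.queryString (p.cfg (Sum.inr false) T) = y := h2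
      have hq2 : p.machine.queryError (p.cfg (Sum.inr false) T) = e := h1
      rw [hq1, hq2]
      exact ⟨⟨J, hJ⟩, he, by simp [polyBound]⟩
    · obtain ⟨u, rfl⟩ := Nat.exists_eq_add_of_lt htt
      rw [add_assoc, machine_run_halted heq, PMF.mem_support_map_iff] at hc
      obtain ⟨s, -, rfl⟩ := hc
      exact absurd (Sum.inr_injective (hq : (Sum.inr true : p.Pos ⊕ Bool) = Sum.inr false))
        Bool.false_ne_true.symm
  · intro x I hI e he O t ht c hc
    obtain ⟨y, J, hJ, -, hy⟩ := hrun x I hI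
    obtain ⟨T, t', htt, h2, h1, hlt, heq⟩ := hy e O
    rw [hP, Nat.cast_le] at ht
    obtain ⟨u, rfl⟩ := Nat.exists_eq_add_of_lt (show t' < t by omega)
    rw [add_assoc, machine_run_halted heq, PMF.mem_support_map_iff] at hc
    obtain ⟨s, -, rfl⟩ := hc
    rfl
  · intro O hO x I hI e he
    obtain ⟨y, J, hJ, hcount, hy⟩ := hrun x I hI
    obtain ⟨T, t', htt, h2, h1, hlt, heq⟩ := hy e O
    have hout : p.machine.output O x e
        ⌈polyBound (Polynomial.aeval (MvPolynomial.X 0) P + 1) x e⌉₊ = O y e := by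
      rw [hP, Nat.ceil_natCast]
      obtain ⟨u, hu⟩ := Nat.exists_eq_add_of_lt (show t' < P.eval x.length + 1 by omega)
      rw [hu, add_assoc, OracleMachine.output, machine_run_halted heq, PMF.map_comp, h1, h2]
      convert PMF.map_id _ using 2
      funext s
      exact tapeString_stringTape s
    change Approximates (p.machine.output O x e _) _ _
    rw [hout, ← hcount]
    exact hO y J hJ e he

/-! ### Tapes given by lists -/

/-- The tape with `l` (read from the head outwards) to the left and `r` to the right; the head
scans the first symbol of `r`. -/
def listTape (l r : List (Option Bool)) : Turing.Tape (Option Bool) :=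
  Turing.Tape.mk' (Turing.ListBlank.mk l) (Turing.ListBlank.mk r)

section listTape

variable (l r : List (Option Bool)) (a b : Option Bool)

theorem listBlank_mk_blank :
    (Turing.ListBlank.mk [none] : Turing.ListBlank (Option Bool)) = Turing.ListBlank.mk [] :=
  Turing.ListBlank.ext fun i => by cases i <;> rfl

@[simp] theorem listTape_blank_left : listTape [none] r = listTape [] r := by
  rw [listTape, listBlank_mk_blank, listTape]

@[simp] theorem listTape_blank_right : listTape l [none] = listTape l [] := by
  rw [listTape, listBlank_mk_blank, listTape]

@[simp] theorem listTape_head_cons : (listTape l (a :: r)).head = a := rfl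

@[simp] theorem listTape_head_nil : (listTape l []).head = none := rfl

@[simp] theorem listTape_write_cons : (listTape l (a :: r)).write b = listTape l (b :: r) := rfl

@[simp] theorem listTape_write_nil : (listTape l []).write b = listTape l [b] := rfl

@[simp] theorem listTape_right_cons :
    (listTape l (a :: r)).move Turing.Dir.right = listTape (a :: l) r := by
  simp [listTape]

@[simp] theorem listTape_left_cons :
    (listTape (a :: l) r).move Turing.Dir.left = listTape l (a :: r) := by
  simp [listTape]

@[simp] theorem listTape_left_nil :
    (listTape [] r).move Turing.Dir.left = listTape [] (none :: r) := by
  simp [listTape, show (default : Option Bool) = none from rfl]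

end listTape

theorem stringTape_eq_listTape (s : List Bool) :
    OracleMachine.stringTape s = listTape [] (s.map some) := rfl

/-- A stack with its top to the left; the head scans the blank in front of the top. -/
def stackTape (q : List Bool) : Turing.Tape (Option Bool) := listTape [] (none :: q.map some)

theorem tapeString_stackTape (q : List Bool) : tapeString (stackTape q) = q := by
  rw [tapeString, stackTape, listTape, Turing.Tape.mk'_left, Turing.Tape.mk'_right₀]
  exact halfTapeString_mk_map_some q

/-! ### Stacks, the tape layout and elementary programs -/

namespace TapeProgram

/-- Pop a symbol of the input. -/
def pop : TapeOp := TapeOp.put none Turing.Dir.right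

/-- Push a symbol on a stack. -/
def push (b : Bool) : TapeOp := TapeOp.put (some b) Turing.Dir.left

/-- The popped cell is blanked, and a blank at the far left is indistinguishable from unused tape;
so reading the input consumes it without trace. -/
theorem pop_stringTape (b : Bool) (s : List Bool) :
    pop.apply (OracleMachine.stringTape (b :: s)) = OracleMachine.stringTape s := by
  simp [pop, stringTape_eq_listTape]

theorem push_stackTape (b : Bool) (q : List Bool) :
    (push b).apply (stackTape q) = stackTape (b :: q) := by
  simp [push, stackTape]

/-- Input `s`, error bound `e`, query stack `q` and two work tapes. -/
def layout (e s q : List Bool) (F C : Turing.Tape (Option Bool)) : Tapes 6 :=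
  ![OracleMachine.stringTape s, OracleMachine.stringTape e, stackTape q,
    OracleMachine.stringTape [], F, C]

/-- Operations on the input tape, the query tape and the two work tapes. -/
def ops (i q f c : TapeOp) : Fin 6 → TapeOp := ![i, TapeOp.keep, q, TapeOp.keep, f, c]

theorem initTapes_eq_layout (x e : List Bool) :
    initTapes x e = layout e x [] (listTape [] []) (listTape [] []) := by
  funext i
  fin_cases i <;> rfl

theorem computes_ops {i q f c : TapeOp} {e s s' w w' : List Bool}
    {F F' C C' : Turing.Tape (Option Bool)}
    (hs : i.apply (OracleMachine.stringTape s) = OracleMachine.stringTape s')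
    (hq : q.apply (stackTape w) = stackTape w') (hF : f.apply F = F') (hC : c.apply C = C') :
    (act (ops i q f c)).Computes (layout e s w F C) 1 (layout e s' w' F' C') := by
  convert computes_act (ops i q f c) (layout e s w F C) using 1
  funext t
  fin_cases t
  · exact hs.symm
  · exact (TapeOp.apply_keep _).symm
  · exact hq.symm
  · exact (TapeOp.apply_keep _).symm
  · exact hF.symm
  · exact hC.symm

variable {e s q : List Bool} {F C : Turing.Tape (Option Bool)}

@[simp] theorem heads_layout_five : heads (layout e s q F C) 5 = C.head := rfl

/-- Do nothing. -/
def nop : TapeProgram 6 := act (ops TapeOp.keep TapeOp.keep TapeOp.keep TapeOp.keep)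

theorem computes_nop : nop.Computes (layout e s q F C) 1 (layout e s q F C) :=
  computes_ops (TapeOp.apply_keep _) (TapeOp.apply_keep _) (TapeOp.apply_keep _)
    (TapeOp.apply_keep _)

/-- Push a symbol on the query stack. -/
def pushBit (b : Bool) : TapeProgram 6 :=
  act (ops TapeOp.keep (push b) TapeOp.keep TapeOp.keep)

theorem computes_pushBit (b : Bool) :
    (pushBit b).Computes (layout e s q F C) 1 (layout e s (b :: q) F C) :=
  computes_ops (TapeOp.apply_keep _) (push_stackTape b q) (TapeOp.apply_keep _)
    (TapeOp.apply_keep _)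

/-- Push a constant in unary on the query stack. -/
def pushUnary : ℕ → TapeProgram 6
  | 0 => pushBit false
  | t + 1 => seq (pushUnary t) (pushBit true)

theorem computes_pushUnary (t : ℕ) :
    (pushUnary t).Computes (layout e s q F C) (t + 1) (layout e s (unary t ++ q) F C) := by
  induction t with
  | zero => exact computes_pushBit false
  | succ t ih => exact ih.seq (computes_pushBit true)

/-! ### Counters -/

/-- The counter value `v` to the left of the head, and `r` from the head on. -/
def counterTape (v : ℕ) (r : List (Option Bool)) : Turing.Tape (Option Bool) :=
  listTape (List.replicate v (some true)) r

/-- Move the head of one work tape (the first if `i`), and push `b` on the query stack. -/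
def shiftPush (i : Bool) (D : Turing.Dir) (b : Bool) : TapeProgram 6 :=
  act (ops TapeOp.keep (push b) (bif i then TapeOp.shift D else TapeOp.keep)
    (bif i then TapeOp.keep else TapeOp.shift D))

/-- Move the head of one work tape. -/
def shiftHead (i : Bool) (D : Turing.Dir) : TapeProgram 6 :=
  act (ops TapeOp.keep TapeOp.keep (bif i then TapeOp.shift D else TapeOp.keep)
    (bif i then TapeOp.keep else TapeOp.shift D))

/-- A work tape scans a `1`. -/
def scansOne (i : Bool) (h : Fin 6 → Option Bool) : Bool :=
  (bif i then h 4 else h 5) == some true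

/-- The layout in which the work tape selected by `i` is `X`, and the other one is `Y`. -/
def selLayout (i : Bool) (e s q : List Bool) (X Y : Turing.Tape (Option Bool)) : Tapes 6 :=
  layout e s q (bif i then X else Y) (bif i then Y else X)

variable {X Y : Turing.Tape (Option Bool)}

theorem computes_shiftPush (i : Bool) (D : Turing.Dir) (b : Bool) :
    (shiftPush i D b).Computes (selLayout i e s q X Y) 1
      (selLayout i e s (b :: q) (X.move D) Y) := by
  cases i
  · exact computes_ops (TapeOp.apply_keep _) (push_stackTape b q) (TapeOp.apply_keep _)
      (TapeOp.apply_shift _ _)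
  · exact computes_ops (TapeOp.apply_keep _) (push_stackTape b q) (TapeOp.apply_shift _ _)
      (TapeOp.apply_keep _)

theorem computes_shiftHead (i : Bool) (D : Turing.Dir) :
    (shiftHead i D).Computes (selLayout i e s q X Y) 1 (selLayout i e s q (X.move D) Y) := by
  cases i
  · exact computes_ops (TapeOp.apply_keep _) (TapeOp.apply_keep _) (TapeOp.apply_keep _)
      (TapeOp.apply_shift _ _)
  · exact computes_ops (TapeOp.apply_keep _) (TapeOp.apply_keep _) (TapeOp.apply_shift _ _)
      (TapeOp.apply_keep _)

theorem scansOne_selLayout (i : Bool) :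
    scansOne i (heads (selLayout i e s q X Y)) = (X.head == some true) := by
  cases i <;> rfl

/-- Push the value of a counter in unary on the query stack. -/
def emit (i : Bool) : TapeProgram 6 :=
  seq (shiftPush i Turing.Dir.left false)
    (seq (loop (scansOne i) (shiftPush i Turing.Dir.left true))
      (seq (shiftHead i Turing.Dir.right)
        (loop (scansOne i) (shiftHead i Turing.Dir.right))))

theorem replicate_append_cons {α : Type*} (a : α) (k : ℕ) (l : List α) :
    List.replicate k a ++ a :: l = List.replicate (k + 1) a ++ l := by
  rw [List.replicate_succ', List.append_assoc, List.singleton_append]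

/-- The parameter `b` counts the `1`s already passed, to make the induction go through. Positions
are described as one move to the left of a counter tape, so that the stopping position, the blank
before the first `1`, has the same form as the others. -/
theorem computes_sweep_left (i : Bool) (r : List (Option Bool)) (a : ℕ) : ∀ (b : ℕ) (q : List Bool),
    (loop (scansOne i) (shiftPush i Turing.Dir.left true)).Computes
      (selLayout i e s q
        ((counterTape a (List.replicate b (some true) ++ r)).move Turing.Dir.left) Y)
      (2 * a + 1)
      (selLayout i e s (List.replicate a true ++ q)
        ((counterTape 0 (List.replicate (a + b) (some true) ++ r)).move Turing.Dir.left) Y) := by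
  induction a with
  | zero =>
    intro b q
    rw [zero_add]
    refine computes_loop_of_false _ ?_
    rw [scansOne_selLayout]
    simp [counterTape]
  | succ a ih =>
    intro b q
    have h := ih (b + 1) (true :: q)
    rw [replicate_append_cons, ← add_assoc, add_right_comm] at h
    refine (computes_loop_of_true ?_ (computes_shiftPush i _ true) ?_).mono
      (b := 1 + (2 * a + 1) + 1) (by omega)
    · rw [scansOne_selLayout]
      simp [counterTape, List.replicate_succ]
    · convert h using 3
      simp [counterTape, List.replicate_succ]

theorem computes_sweep_right (i : Bool) {r : List (Option Bool)}
    (hr : r.head? ≠ some (some true)) (b : ℕ) : ∀ a : ℕ,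
    (loop (scansOne i) (shiftHead i Turing.Dir.right)).Computes
      (selLayout i e s q (counterTape a (List.replicate b (some true) ++ r)) Y)
      (2 * b + 1) (selLayout i e s q (counterTape (a + b) r) Y) := by
  induction b with
  | zero =>
    intro a
    refine computes_loop_of_false _ ?_
    rw [scansOne_selLayout]
    cases r with
    | nil => simp [counterTape]
    | cons c r => simpa [counterTape] using hr
  | succ b ih =>
    intro a
    have h := ih (a + 1)
    rw [add_assoc, add_comm 1 b] at h
    refine (computes_loop_of_true ?_ (computes_shiftHead i _) ?_).mono
      (b := 1 + (2 * b + 1) + 1) (by omega)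
    · rw [scansOne_selLayout]
      simp [counterTape, List.replicate_succ]
    · convert h using 2
      simp [counterTape, List.replicate_succ]

/-- The stack grows to the left, so the terminating `0` is pushed first, then a `1` for each `1`
passed on the way left. The way back stops at the original position because `r` does not begin with
a `1`. -/
theorem computes_emit (i : Bool) (v : ℕ) {r : List (Option Bool)}
    (hr : r.head? ≠ some (some true)) :
    (emit i).Computes (selLayout i e s q (counterTape v r) Y) (4 * v + 4)
      (selLayout i e s (unary v ++ q) (counterTape v r) Y) := by
  have h1 := computes_sweep_left (e := e) (s := s) (Y := Y) i r v 0 (false :: q)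
  have h2 := computes_shiftHead (e := e) (s := s) (q := unary v ++ q) (Y := Y) i Turing.Dir.right
    (X := (counterTape 0 (List.replicate (v + 0) (some true) ++ r)).move Turing.Dir.left)
  have h3 := computes_sweep_right (e := e) (s := s) (q := unary v ++ q) (Y := Y) i hr v 0
  rw [Turing.Tape.move_left_right] at h2
  rw [zero_add] at h3
  refine ((computes_shiftPush i _ false).seq
    (Computes.seq ?_ (h2.seq h3))).mono (b := 1 + (2 * v + 1 + (1 + (2 * v + 1)))) (by omega)
  convert h1 using 2
  · rw [List.replicate_zero, List.nil_append]
  · rw [unary, List.append_assoc, List.singleton_append]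

theorem computes_emit_first (f : ℕ) : (emit true).Computes (layout e s q (counterTape f []) C)
    (4 * f + 4) (layout e s (unary f ++ q) (counterTape f []) C) :=
  computes_emit (Y := C) true f (by simp)

theorem computes_emit_second (v : ℕ) {r : List (Option Bool)} (hr : r.head? ≠ some (some true)) :
    (emit false).Computes (layout e s q F (counterTape v r))
      (4 * v + 4) (layout e s (unary v ++ q) F (counterTape v r)) :=
  computes_emit (Y := F) false v hr

/-- Increment the first counter. -/
def inc : TapeProgram 6 :=
  act (ops TapeOp.keep TapeOp.keep (TapeOp.put (some true) Turing.Dir.right) TapeOp.keep)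

theorem put_true_counterTape (f : ℕ) :
    (TapeOp.put (some true) Turing.Dir.right).apply (counterTape f []) =
      counterTape (f + 1) [] := by
  simp [counterTape, List.replicate_succ]

theorem computes_inc (f : ℕ) : inc.Computes (layout e s q (counterTape f []) C) 1
    (layout e s q (counterTape (f + 1) []) C) :=
  computes_ops (TapeOp.apply_keep _) (TapeOp.apply_keep _) (put_true_counterTape f)
    (TapeOp.apply_keep _)

/-- Add a constant to the first counter. -/
def incs : ℕ → TapeProgram 6
  | 0 => nop
  | j + 1 => seq (incs j) inc

theorem computes_incs (j f : ℕ) : (incs j).Computes (layout e s q (counterTape f []) C) (j + 1)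
    (layout e s q (counterTape (f + j) []) C) := by
  induction j with
  | zero => exact computes_nop
  | succ j ih => exact ih.seq (computes_inc _)

/-- Decrement the first counter. -/
def dec : TapeProgram 6 :=
  seq (act (ops TapeOp.keep TapeOp.keep (TapeOp.shift Turing.Dir.left) TapeOp.keep))
    (act (ops TapeOp.keep TapeOp.keep TapeOp.erase TapeOp.keep))

/-- The head rests on the blank after the counter; it steps back onto the last `1` and erases it. -/
theorem computes_dec (f : ℕ) : dec.Computes (layout e s q (counterTape (f + 1) []) C) 2
    (layout e s q (counterTape f []) C) := by
  refine Computes.seq (T₁ := layout e s q (counterTape f [some true]) C) (b := 1) (b' := 1)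
    (computes_ops (TapeOp.apply_keep _) (TapeOp.apply_keep _) ?_ (TapeOp.apply_keep _))
    (computes_ops (TapeOp.apply_keep _) (TapeOp.apply_keep _) ?_ (TapeOp.apply_keep _)) <;>
  simp [counterTape, List.replicate_succ]

end TapeProgram

/-! ### The reduction as a tape program -/

/-- The positions of the `1`s in a bit string, counted from `v`. -/
def onesFrom : ℕ → List Bool → List ℕ
  | _, [] => []
  | v, true :: bs => v :: onesFrom (v + 1) bs
  | v, false :: bs => onesFrom (v + 1) bs

/-- The scope of a gadget with fresh variables `f, f + 1, …`: the slots below `j`, taken from the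
top, are filled with the variables in `es` for as long as there are any. -/
def fillSlots (slot : ℕ → Bool) (f : ℕ) : ℕ → List ℕ → ℕ → ℕ
  | 0, _ => fun i => f + i
  | j + 1, es =>
    if slot j then Function.update (fillSlots slot f j es.tail) j (es.head?.getD (f + j))
    else fillSlots slot f j es

/-- The name of the pin to `b`. -/
def pinName (b : Bool) : ℕ := bif b then 2 else 1

/-- The pins of the fresh variables `f, …, f + j - 1`. -/
def pinsCode (val : ℕ → Bool) (f : ℕ) : ℕ → List Bool
  | 0 => []
  | j + 1 => unary (pinName (val j)) ++ unary (f + j) ++ pinsCode val f j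

/-- The constraints for one hyper-edge. -/
def gadgetCode (r : ℕ) (slot val : ℕ → Bool) (f : ℕ) (es : List ℕ) : List Bool :=
  unary 0 ++ (List.range r).flatMap (fun i => unary (fillSlots slot f r es i)) ++ pinsCode val f r

/-- The constraints for all hyper-edges, the last one first, in front of `q`. -/
def gadgetsCode (r : ℕ) (slot val : ℕ → Bool) : ℕ → List (List Bool) → List Bool → List Bool
  | _, [], q => q
  | f, bs :: rows, q =>
    gadgetsCode r slot val (f + r) rows (gadgetCode r slot val f (onesFrom 0 bs) ++ q)

theorem fillSlots_of_le (slot : ℕ → Bool) (f : ℕ) {j i : ℕ} (h : j ≤ i) :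
    ∀ es, fillSlots slot f j es i = f + i := by
  induction j with
  | zero => intro es; rfl
  | succ j ih =>
    intro es
    rw [fillSlots]
    split
    · rw [Function.update_of_ne (by omega), ih (by omega)]
    · exact ih (by omega) es

/-! ### Programs for one hyper-edge and for the whole input -/

namespace TapeProgram

variable {e s q : List Bool} {F C : Turing.Tape (Option Bool)}

/-- The second work tape in the middle of a row: `v` symbols have been read, `u` are left. -/
def rowTape (v u : ℕ) : Turing.Tape (Option Bool) :=
  counterTape v (List.replicate u (some false))

/-- Cells for unread symbols hold `0`: unlike a `1`, it ends the unary index of the current vertex,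
and unlike a blank, it shows that the row is not over. -/
theorem head?_replicate_false (u : ℕ) :
    (List.replicate u (some false)).head? ≠ some (some true) := by
  cases u <;> simp [List.replicate_succ]

/-- Read one symbol of a row. -/
def advance : TapeProgram 6 :=
  act (ops pop TapeOp.keep TapeOp.keep (TapeOp.put (some true) Turing.Dir.right))

theorem computes_advance (b : Bool) (v u : ℕ) :
    advance.Computes (layout e (b :: s) q F (rowTape v (u + 1))) 1
      (layout e s q F (rowTape (v + 1) u)) :=
  computes_ops (pop_stringTape b s) (TapeOp.apply_keep _) (TapeOp.apply_keep _)
    (by simp [rowTape, counterTape, List.replicate_succ])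

/-- The row is not over. -/
def inRow (h : Fin 6 → Option Bool) : Bool := h 5 != none

/-- Skip the rest of a row. -/
def skipRow : TapeProgram 6 := loop inRow advance

theorem computes_skipRow (bs : List Bool) : ∀ v : ℕ,
    skipRow.Computes (layout e (bs ++ s) q F (rowTape v bs.length)) (2 * bs.length + 1)
      (layout e s q F (rowTape (v + bs.length) 0)) := by
  induction bs with
  | nil => exact fun v => computes_loop_of_false _ rfl
  | cons b bs ih =>
    intro v
    have h := ih (v + 1)
    rw [add_assoc, add_comm 1 bs.length] at h
    exact (computes_loop_of_true rfl (computes_advance b v bs.length) h).mono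
      (by simp only [List.length_cons]; omega)

/-- Skip `0`s within a row. -/
def seekOne : TapeProgram 6 := loop (fun h => inRow h && h 0 != some true) advance

/-- Skipping `0`s changes neither the vertices still to come nor the total length of the row.
Afterwards either the row is exhausted or a `1` is scanned, so `inRow` tells whether a vertex is
left. -/
theorem computes_seekOne (bs : List Bool) : ∀ v : ℕ, ∃ v' bs',
    seekOne.Computes (layout e (bs ++ s) q F (rowTape v bs.length)) (2 * bs.length + 1)
      (layout e (bs' ++ s) q F (rowTape v' bs'.length)) ∧
    onesFrom v' bs' = onesFrom v bs ∧ v' + bs'.length = v + bs.length ∧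
    (bs' = [] ∨ ∃ bs'', bs' = true :: bs'') := by
  induction bs with
  | nil => exact fun v => ⟨v, [], computes_loop_of_false _ rfl, rfl, rfl, Or.inl rfl⟩
  | cons b bs ih =>
    intro v
    cases b with
    | true =>
      exact ⟨v, true :: bs, (computes_loop_of_false _ rfl).mono (by omega), rfl, rfl,
        Or.inr ⟨bs, rfl⟩⟩
    | false =>
      obtain ⟨v', bs', h, h1, h2, h3⟩ := ih (v + 1)
      refine ⟨v', bs', (computes_loop_of_true rfl (computes_advance false v bs.length) h).mono ?_,
        h1, ?_, h3⟩ <;> simp only [List.length_cons] <;> omega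

/-- Push the next vertex of the current row, or the first counter if there is none. -/
def fillSlot : TapeProgram 6 :=
  seq seekOne (ite inRow (seq (emit false) advance) (emit true))

theorem computes_fillSlot {B : ℕ} (bs : List Bool) (v f : ℕ) (hf : f ≤ B)
    (hv : v + bs.length ≤ B) : ∃ v' bs',
    fillSlot.Computes (layout e (bs ++ s) q (counterTape f []) (rowTape v bs.length)) (6 * B + 7)
      (layout e (bs' ++ s) (unary ((onesFrom v bs).head?.getD f) ++ q) (counterTape f [])
        (rowTape v' bs'.length)) ∧
    onesFrom v' bs' = (onesFrom v bs).tail ∧ v' + bs'.length = v + bs.length := by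
  obtain ⟨v', bs', h, h1, h2, h3⟩ :=
    computes_seekOne (e := e) (s := s) (q := q) (F := counterTape f []) bs v
  rcases h3 with rfl | ⟨bs'', rfl⟩
  · refine ⟨v', [], ?_, by rw [← h1]; rfl, h2⟩
    rw [← h1]
    exact (h.seq (computes_ite_of_false _ rfl (computes_emit_first f))).mono (by omega)
  -- A `1` is scanned: the number `v'` of symbols read so far is the index of the vertex.
  · simp only [List.length_cons] at h2
    refine ⟨v' + 1, bs'', ?_, by rw [← h1]; rfl, by omega⟩
    rw [← h1]
    exact (h.seq (computes_ite_of_true _ rfl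
      ((computes_emit_second v' (head?_replicate_false _)).seq (computes_advance true _ _)))).mono
      (by omega)

/-- Push the scope of a gadget, decrementing the first counter. -/
def pushScope (slot : ℕ → Bool) : ℕ → TapeProgram 6
  | 0 => nop
  | j + 1 => seq dec (seq (if slot j then fillSlot else emit true) (pushScope slot j))

/-- Arguments are pushed from the last to the first. The counter starts at `f + j` and is
decremented before each argument, so that it always holds the fresh variable of the argument being
pushed, which is the default content of that argument. -/
theorem computes_pushScope {B : ℕ} (slot : ℕ → Bool) (f j : ℕ) (hf : f + j ≤ B) :
    ∀ (bs q : List Bool) (v : ℕ), v + bs.length ≤ B → ∃ v' bs',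
    (pushScope slot j).Computes
      (layout e (bs ++ s) q (counterTape (f + j) []) (rowTape v bs.length)) (j * (6 * B + 9) + 1)
      (layout e (bs' ++ s)
        ((List.range j).flatMap (fun i => unary (fillSlots slot f j (onesFrom v bs) i)) ++ q)
        (counterTape f []) (rowTape v' bs'.length)) ∧
    v' + bs'.length = v + bs.length := by
  induction j with
  | zero => exact fun bs q v _ => ⟨v, bs, computes_nop.mono (by omega), rfl⟩
  | succ j ih =>
    intro bs q v hv
    -- The last argument is split off because it is pushed first; the recursion of `fillSlots`
    -- alters the remaining scope only at that argument.
    have hflat : ∀ (g g' : ℕ → ℕ) (a : ℕ), (∀ i < j, g i = g' i) → g j = a →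
        (List.range (j + 1)).flatMap (fun i => unary (g i)) ++ q =
          (List.range j).flatMap (fun i => unary (g' i)) ++ (unary a ++ q) := by
      intro g g' a h1 h2
      rw [List.range_succ, List.flatMap_append, List.append_assoc, List.flatMap_singleton, h2]
      congr 1
      simp only [List.flatMap_def]
      congr 1
      exact List.map_congr_left fun i hi => by rw [h1 i (List.mem_range.1 hi)]
    rw [pushScope, fillSlots]
    by_cases hj : slot j = true
    · obtain ⟨v₁, bs₁, h1, ho, hl⟩ := computes_fillSlot (e := e) (s := s) (q := q) bs v (f + j)
        (by omega) hv
      obtain ⟨v', bs', h2, hl'⟩ := ih (by omega) bs₁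
        (unary ((onesFrom v bs).head?.getD (f + j)) ++ q) v₁ (by omega)
      refine ⟨v', bs', ?_, by omega⟩
      rw [ho] at h2
      rw [if_pos hj, if_pos hj, hflat _ (fillSlots slot f j (onesFrom v bs).tail) _
        (fun i hi => Function.update_of_ne (by omega) _ _) (Function.update_self ..)]
      refine ((computes_dec (f + j)).seq (h1.seq h2)).mono ?_
      rw [add_mul]
      omega
    · obtain ⟨v', bs', h2, hl'⟩ := ih (by omega) bs (unary (f + j) ++ q) v hv
      refine ⟨v', bs', ?_, hl'⟩
      rw [if_neg hj, if_neg hj, hflat _ (fillSlots slot f j (onesFrom v bs)) _ (fun _ _ => rfl)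
        (fillSlots_of_le slot f le_rfl _)]
      refine ((computes_dec (f + j)).seq ((computes_emit_first (f + j)).seq h2)).mono ?_
      rw [add_mul]
      omega

/-- Push the pins of the next `j` fresh variables, incrementing the first counter. -/
def pushPins (val : ℕ → Bool) : ℕ → TapeProgram 6
  | 0 => nop
  | j + 1 => seq (pushPins val j) (seq (emit true) (seq (pushUnary (pinName (val j))) inc))

theorem computes_pushPins {B : ℕ} (val : ℕ → Bool) (f j : ℕ) (hf : f + j ≤ B) :
    (pushPins val j).Computes (layout e s q (counterTape f []) C) (j * (4 * B + 8) + 1)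
      (layout e s (pinsCode val f j ++ q) (counterTape (f + j) []) C) := by
  induction j with
  | zero => exact computes_nop.mono (by omega)
  | succ j ih =>
    have hp : pinName (val j) ≤ 2 := by cases val j <;> simp [pinName]
    have h := (ih (by omega)).seq ((computes_emit_first (f + j)).seq
      ((computes_pushUnary (pinName (val j))).seq (computes_inc (f + j))))
    simp only [← List.append_assoc] at h
    refine Computes.mono h ?_
    rw [add_mul]
    omega

/-- Return to the beginning of a row on the second work tape. -/
def rewind : TapeProgram 6 :=
  seq (shiftHead false Turing.Dir.left)
    (seq (loop (scansOne false)
        (act (ops TapeOp.keep TapeOp.keep TapeOp.keep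
          (TapeOp.put (some false) Turing.Dir.left))))
      (shiftHead false Turing.Dir.right))

theorem computes_rewind_loop (v : ℕ) : ∀ u : ℕ,
    (loop (scansOne false) (act (ops TapeOp.keep TapeOp.keep TapeOp.keep
        (TapeOp.put (some false) Turing.Dir.left)))).Computes
      (layout e s q F ((rowTape v u).move Turing.Dir.left)) (2 * v + 1)
      (layout e s q F ((rowTape 0 (v + u)).move Turing.Dir.left)) := by
  induction v with
  | zero =>
    intro u
    rw [zero_add]
    refine computes_loop_of_false _ ?_
    simp [scansOne, rowTape, counterTape]
  | succ v ih =>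
    intro u
    have h := ih (u + 1)
    rw [← add_assoc, add_right_comm] at h
    refine (computes_loop_of_true ?_ (computes_ops (TapeOp.apply_keep _) (TapeOp.apply_keep _)
      (TapeOp.apply_keep _) ?_) h).mono (by omega)
    · simp [scansOne, rowTape, counterTape, List.replicate_succ]
    · simp [rowTape, counterTape, List.replicate_succ]

theorem computes_rewind (v u : ℕ) :
    rewind.Computes (layout e s q F (rowTape v u)) (2 * v + 3)
      (layout e s q F (rowTape 0 (v + u))) := by
  have h1 := computes_shiftHead (e := e) (s := s) (q := q) (X := rowTape v u) (Y := F) false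
    Turing.Dir.left
  have h2 := computes_shiftHead (e := e) (s := s) (q := q)
    (X := (rowTape 0 (v + u)).move Turing.Dir.left) (Y := F) false Turing.Dir.right
  rw [Turing.Tape.move_left_right] at h2
  exact (h1.seq ((computes_rewind_loop v u).seq h2)).mono (by omega)

/-- Handle one hyper-edge. -/
def handleRow (r : ℕ) (slot val : ℕ → Bool) : TapeProgram 6 :=
  seq (act (ops pop TapeOp.keep TapeOp.keep TapeOp.keep))
    (seq (pushPins val r) (seq (pushScope slot r) (seq (pushUnary 0) (seq (incs r)
      (seq skipRow rewind)))))

theorem computes_handleRow {B : ℕ} (r : ℕ) (slot val : ℕ → Bool) (f : ℕ) (bs : List Bool)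
    (hf : f + r ≤ B) (hn : bs.length ≤ B) :
    (handleRow r slot val).Computes
      (layout e (true :: bs ++ s) q (counterTape f []) (rowTape 0 bs.length))
      ((r + 1) * (10 * B + 20))
      (layout e s (gadgetCode r slot val f (onesFrom 0 bs) ++ q) (counterTape (f + r) [])
        (rowTape 0 bs.length)) := by
  -- The pins have raised the first counter to `f + r`, which is where the scope starts its descent;
  -- `incs r` raises it again for the next hyper-edge.
  obtain ⟨v, bs', h, hl⟩ := computes_pushScope (e := e) (s := s) slot f r hf bs
    (pinsCode val f r ++ q) 0 (by omega)
  have hskip := computes_skipRow (e := e) (s := s) (F := counterTape (f + r) [])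
    (q := gadgetCode r slot val f (onesFrom 0 bs) ++ q) bs' v
  have hrew := computes_rewind (e := e) (s := s) (F := counterTape (f + r) [])
    (q := gadgetCode r slot val f (onesFrom 0 bs) ++ q) (v + bs'.length) 0
  rw [zero_add] at hl
  rw [add_zero, hl] at hrew
  rw [hl] at hskip
  have hpush := computes_pushUnary (e := e) (s := bs' ++ s) (F := counterTape f [])
    (C := rowTape v bs'.length) 0 (q := (List.range r).flatMap
      (fun i => unary (fillSlots slot f r (onesFrom 0 bs) i)) ++ (pinsCode val f r ++ q))
  have hg : unary 0 ++ ((List.range r).flatMap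
      (fun i => unary (fillSlots slot f r (onesFrom 0 bs) i)) ++ (pinsCode val f r ++ q)) =
      gadgetCode r slot val f (onesFrom 0 bs) ++ q := by
    simp only [gadgetCode, List.append_assoc]
  rw [hg] at hpush
  refine ((computes_ops (pop_stringTape true _) (TapeOp.apply_keep _) (TapeOp.apply_keep _)
    (TapeOp.apply_keep _)).seq ((computes_pushPins val f r hf).seq (h.seq
      (hpush.seq ((computes_incs r f).seq (hskip.seq hrew)))))).mono ?_
  -- The costs proportional to `r`: pins, scope and the final increments. Skipping and rewinding the
  -- row are absorbed by the extra summand `10 * B + 20`.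
  have : r * (4 * B + 8) + r * (6 * B + 9) + r = r * (10 * B + 18) := by ring
  have : r * (10 * B + 18) ≤ r * (10 * B + 20) := Nat.mul_le_mul_left _ (by omega)
  rw [add_mul]
  omega

/-- Handle all hyper-edges. -/
def handleRows (r : ℕ) (slot val : ℕ → Bool) : TapeProgram 6 :=
  loop (fun h => h 0 != none) (handleRow r slot val)

theorem computes_handleRows {B n : ℕ} (r : ℕ) (slot val : ℕ → Bool) (hn : n ≤ B)
    (rows : List (List Bool)) (hrows : ∀ bs ∈ rows, bs.length = n) : ∀ (f : ℕ) (q : List Bool),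
    f + rows.length * r ≤ B →
    (handleRows r slot val).Computes
      (layout e (rows.flatMap (List.cons true)) q (counterTape f []) (rowTape 0 n))
      (rows.length * ((r + 1) * (10 * B + 20) + 1) + 1)
      (layout e [] (gadgetsCode r slot val f rows q) (counterTape (f + rows.length * r) [])
        (rowTape 0 n)) := by
  induction rows with
  | nil =>
    intro f q _
    simp only [List.length_nil, zero_mul, add_zero, zero_add]
    exact computes_loop_of_false _ rfl
  | cons bs rows ih =>
    intro f q hB
    rw [List.length_cons, add_mul, one_mul] at hB
    obtain ⟨rfl, hrows⟩ := List.forall_mem_cons.1 hrows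
    have h := ih hrows (f + r) (gadgetCode r slot val f (onesFrom 0 bs) ++ q) (by omega)
    have h' := computes_loop_of_true (c := fun h => h 0 != none) rfl
      (computes_handleRow (e := e) (q := q) (s := rows.flatMap (List.cons true)) r slot val f bs
        (by omega) hn) h
    have hfr : f + r + rows.length * r = f + (rows.length + 1) * r := by ring
    rw [hfr] at h'
    refine Computes.mono h' ?_
    rw [List.length_cons]
    generalize (r + 1) * (10 * B + 20) = K
    rw [add_one_mul]
    omega

/-- Read the number of vertices. -/
def readHeader : TapeProgram 6 :=
  seq (loop (fun h => h 0 == some true)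
      (act (ops pop TapeOp.keep (TapeOp.put (some true) Turing.Dir.right) (push false))))
    (act (ops pop TapeOp.keep TapeOp.keep (TapeOp.shift Turing.Dir.right)))

theorem stackTape_move_right (w : List Bool) :
    (stackTape w).move Turing.Dir.right = OracleMachine.stringTape w := by
  simp [stackTape, stringTape_eq_listTape]

theorem computes_readHeader_loop (n : ℕ) : ∀ (f : ℕ) (w : List Bool),
    (loop (fun h => h 0 == some true)
      (act (ops pop TapeOp.keep (TapeOp.put (some true) Turing.Dir.right)
        (push false)))).Computes
      (layout e (unary n ++ s) q (counterTape f []) (stackTape w)) (2 * n + 1)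
      (layout e (false :: s) q (counterTape (f + n) [])
        (stackTape (List.replicate n false ++ w))) := by
  induction n with
  | zero => exact fun f w => computes_loop_of_false _ rfl
  | succ n ih =>
    intro f w
    have h := ih (f + 1) (false :: w)
    rw [add_assoc, add_comm 1 n, replicate_append_cons] at h
    exact (computes_loop_of_true rfl (computes_ops (pop_stringTape true _) (TapeOp.apply_keep _)
      (put_true_counterTape f) (push_stackTape false w)) h).mono (by omega)

/-- Each `1` of the header is recorded twice: in the first counter, since fresh variables are
numbered from `n`, and as a `0` cell on the second work tape, to measure out the rows. The last step
removes the terminator and moves onto the first cell. -/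
theorem computes_readHeader (n : ℕ) :
    readHeader.Computes (layout e (unary n ++ s) q (listTape [] []) (listTape [] [])) (2 * n + 2)
      (layout e s q (counterTape n []) (rowTape 0 n)) := by
  have h := computes_readHeader_loop (e := e) (s := s) (q := q) n 0 []
  rw [zero_add, List.append_nil] at h
  have h0 : stackTape [] = listTape [] [] := listTape_blank_right []
  rw [h0] at h
  refine (h.seq (computes_ops (pop_stringTape false s) (TapeOp.apply_keep _)
    (TapeOp.apply_keep _) ?_)).mono (by omega)
  rw [TapeOp.apply_shift, stackTape_move_right, stringTape_eq_listTape, List.map_replicate]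
  rfl

/-- The whole reduction. -/
def reduction (r : ℕ) (slot val : ℕ → Bool) : TapeProgram 6 :=
  seq readHeader (seq (handleRows r slot val) (emit true))

theorem computes_reduction (r : ℕ) (slot val : ℕ → Bool) (e : List Bool) (n : ℕ)
    (rows : List (List Bool)) (hrows : ∀ bs ∈ rows, bs.length = n) : ∃ T,
    (reduction r slot val).Computes (initTapes (unary n ++ rows.flatMap (List.cons true)) e)
      ((n + rows.length + 1) * ((r + 1) * (10 * ((r + 1) * (n + rows.length)) + 30))) T ∧
    tapeString (T 2) = unary (n + rows.length * r) ++ gadgetsCode r slot val n rows [] ∧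
    tapeString (T 1) = e := by
  set m := rows.length with hm
  set B := (r + 1) * (n + m) with hB
  -- This exhibits `n + m * r`, the final value of the first counter, as a summand of `B`.
  have hB' : B = n + m * r + (n * r + m) := by rw [hB]; ring
  have h1 := computes_readHeader (e := e) (s := rows.flatMap (List.cons true)) (q := []) n
  have h2 := computes_handleRows (e := e) (B := B) r slot val (by omega) rows hrows n []
    (by rw [← hm]; omega)
  have h3 := computes_emit_first (e := e) (s := []) (q := gadgetsCode r slot val n rows [])
    (C := rowTape 0 n) (n + m * r)
  rw [initTapes_eq_layout]
  refine ⟨_, (h1.seq (h2.seq h3)).mono ?_, tapeString_stackTape _, tapeString_stringTape _⟩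
  rw [← hm]
  -- The first summand pays for the rows; what is left over covers the header, the end of the loop
  -- and writing the number of variables.
  have e1 : (n + m + 1) * ((r + 1) * (10 * B + 30)) = m * ((r + 1) * (10 * B + 20) + 1) +
      (m * (10 * r + 9) + (n + 1) * ((r + 1) * (10 * B + 30))) := by ring
  have e2 : (n + 1) * (1 * (10 * B + 30)) ≤ (n + 1) * ((r + 1) * (10 * B + 30)) := by
    gcongr
    omega
  have e3 : (n + 1) * (1 * (10 * B + 30)) = 10 * (n * B) + 30 * n + 10 * B + 30 := by ring
  omega

end TapeProgram

/-! ### The scope of a gadget -/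

theorem mem_onesFrom {x : ℕ} (bs : List Bool) : ∀ {v : ℕ},
    x ∈ onesFrom v bs ↔ v ≤ x ∧ bs[x - v]? = some true := by
  induction bs with
  | nil => simp [onesFrom]
  | cons b bs ih =>
    intro v
    rcases lt_trichotomy x v with h | rfl | h
    · cases b <;> simp [onesFrom, ih] <;> omega
    · cases b <;> simp [onesFrom, ih]
    · obtain ⟨d, rfl⟩ := Nat.exists_eq_add_of_lt h
      have h1 : v + d + 1 - (v + 1) = d := by omega
      have h2 : v + d + 1 - v = d + 1 := by omega
      have h3 : (b :: bs)[v + d + 1 - v]? = bs[v + d + 1 - (v + 1)]? := by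
        rw [h1, h2, List.getElem?_cons_succ]
      rw [h3]
      cases b
      · rw [onesFrom, ih]
        exact and_congr_left fun _ => ⟨fun _ => by omega, fun _ => by omega⟩
      · rw [onesFrom, List.mem_cons, ih]
        refine ⟨fun h => ?_, fun h => Or.inr ⟨by omega, h.2⟩⟩
        rcases h with h | h
        · omega
        · exact ⟨by omega, h.2⟩

theorem nodup_onesFrom (bs : List Bool) : ∀ v : ℕ, (onesFrom v bs).Nodup := by
  induction bs with
  | nil => simp [onesFrom]
  | cons b bs ih =>
    intro v
    cases b
    · exact ih (v + 1)
    · exact List.nodup_cons.2 ⟨fun h => absurd ((mem_onesFrom bs).1 h).1 (by omega), ih (v + 1)⟩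

/-- The row of the incidence matrix of a hyper-edge. -/
def edgeRow {n : ℕ} (e : Finset (Fin n)) : List Bool := List.ofFn fun i : Fin n => decide (i ∈ e)

/-- The vertices of a hyper-edge in increasing order. -/
def edgeList {n : ℕ} (e : Finset (Fin n)) : List ℕ := onesFrom 0 (edgeRow e)

theorem mem_edgeList {n : ℕ} {e : Finset (Fin n)} {x : ℕ} :
    x ∈ edgeList e ↔ ∃ v ∈ e, (v : ℕ) = x := by
  rw [edgeList, mem_onesFrom, edgeRow, Nat.sub_zero, List.getElem?_ofFn]
  constructor
  · rintro ⟨-, h⟩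
    split at h
    · exact ⟨_, by simpa using h, rfl⟩
    · simp at h
  · rintro ⟨v, hv, rfl⟩
    simp [hv]

theorem lt_of_mem_edgeList {n : ℕ} {e : Finset (Fin n)} {x : ℕ} (h : x ∈ edgeList e) : x < n := by
  obtain ⟨v, -, rfl⟩ := mem_edgeList.1 h
  exact v.2

theorem nodup_edgeList {n : ℕ} (e : Finset (Fin n)) : (edgeList e).Nodup := nodup_onesFrom _ _

theorem length_edgeList {n : ℕ} (e : Finset (Fin n)) : (edgeList e).length = e.card := by
  rw [← List.toFinset_card_of_nodup (nodup_edgeList e),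
    ← Finset.card_map Fin.valEmbedding]
  congr 1
  ext x
  rw [List.mem_toFinset, mem_edgeList]
  simp

section fillSlots

variable (slot : ℕ → Bool) (f : ℕ)

theorem fillSlots_of_not_slot {i : ℕ} (h : slot i = false) (j : ℕ) :
    ∀ es, fillSlots slot f j es i = f + i := by
  induction j with
  | zero => exact fun es => rfl
  | succ j ih =>
    intro es
    rw [fillSlots]
    split
    · rw [Function.update_of_ne (by rintro rfl; simp_all), ih]
    · exact ih es

theorem fillSlots_mem_or (i j : ℕ) :
    ∀ es, fillSlots slot f j es i ∈ es ∨ fillSlots slot f j es i = f + i := by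
  induction j with
  | zero => exact fun es => Or.inr rfl
  | succ j ih =>
    intro es
    rw [fillSlots]
    split
    · rcases eq_or_ne i j with rfl | hij
      · rw [Function.update_self]
        cases es <;> simp
      · rw [Function.update_of_ne hij]
        exact (ih es.tail).imp_left List.mem_of_mem_tail
    · exact ih es

/-- There are at least as many slots below `j` as list entries, so no entry is left over. -/
theorem exists_fillSlots_eq {x : ℕ} (j : ℕ) : ∀ es : List ℕ,
    es.length ≤ Nat.count (slot · = true) j → x ∈ es →
    ∃ i < j, slot i = true ∧ fillSlots slot f j es i = x := by
  induction j with
  | zero =>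
    intro es h hx
    rw [Nat.count_zero, Nat.le_zero, List.length_eq_zero_iff] at h
    simp [h] at hx
  | succ j ih =>
    intro es h hx
    rw [Nat.count_succ] at h
    rw [fillSlots]
    split
    case isTrue hj =>
      rw [if_pos hj] at h
      cases es with
      | nil => simp at hx
      | cons y es =>
        rcases List.mem_cons.1 hx with rfl | hx
        · exact ⟨j, by omega, hj, by simp⟩
        · obtain ⟨i, hi, hs, hf⟩ := ih es (by simpa using h) hx
          exact ⟨i, by omega, hs, by rw [Function.update_of_ne hi.ne]; exact hf⟩
    case isFalse hj =>
      rw [if_neg hj] at h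
      obtain ⟨i, hi, hs, hf⟩ := ih es h hx
      exact ⟨i, by omega, hs, hf⟩

/-- Listed vertices are distinct and below `f`, whereas the defaults `f + i` are distinct and at
least `f`. -/
theorem fillSlots_injective (j : ℕ) : ∀ es : List ℕ, es.Nodup → (∀ x ∈ es, x < f) →
    Function.Injective (fillSlots slot f j es) := by
  induction j with
  | zero => exact fun es _ _ => add_right_injective f
  | succ j ih =>
    intro es hes hlt
    rw [fillSlots]
    split
    · cases es with
      | nil =>
        have h : Function.update (fillSlots slot f j []) j (f + j) = fillSlots slot f j [] := by
          rw [Function.update_eq_self_iff, fillSlots_of_le slot f le_rfl]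
        simpa [h] using ih [] hes hlt
      | cons y es =>
        obtain ⟨hy, hes⟩ := List.nodup_cons.1 hes
        have hlt' : ∀ x ∈ es, x < f := fun x hx => hlt x (List.mem_cons_of_mem _ hx)
        have hyf := hlt y List.mem_cons_self
        have hne : ∀ i, fillSlots slot f j es i ≠ y := by
          intro i hi
          rcases fillSlots_mem_or slot f i j es with h | h
          · exact hy (hi ▸ h)
          · omega
        intro a b hab
        simp only [List.tail_cons, List.head?_cons, Option.getD_some] at hab
        rcases eq_or_ne a j with rfl | ha
        · rcases eq_or_ne b a with rfl | hb
          · rfl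
          · rw [Function.update_self, Function.update_of_ne hb] at hab
            exact absurd hab.symm (hne b)
        · rcases eq_or_ne b j with rfl | hb
          · rw [Function.update_self, Function.update_of_ne ha] at hab
            exact absurd hab (hne a)
          · rw [Function.update_of_ne ha, Function.update_of_ne hb] at hab
            exact ih es hes hlt' hab
    · exact ih es hes hlt

end fillSlots

/-! ### Gadgets for OR-conj and NAND-conj relations -/

/-- With the arguments outside the slots pinned according to `val`, the relation says that
some argument in a slot has the value `g`. -/
structure IsGadget (R : BoolRel) (slot val : ℕ → Bool) (g : Bool) : Prop where
  val_slot : ∀ j, slot j = true → val j = !g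
  mem_rel : ∀ a : Fin R.arity → Bool, (∀ j : Fin R.arity, slot j = false → a j = val j) →
    (a ∈ R.rel ↔ ∃ j : Fin R.arity, slot j = true ∧ a j = g)

/-- Membership in a list of elements of `Fin r`, as a function on all natural numbers. -/
def memFin {r : ℕ} (c : List (Fin r)) (j : ℕ) : Bool := decide (j ∈ c.map Fin.val)

theorem memFin_val {r : ℕ} {c : List (Fin r)} (j : Fin r) : memFin c j = true ↔ j ∈ c := by
  simp only [memFin, decide_eq_true_eq, List.mem_map]
  exact ⟨fun ⟨i, hi, h⟩ => Fin.ext h ▸ hi, fun h => ⟨j, h, rfl⟩⟩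

theorem memFin_val_eq_false {r : ℕ} {c : List (Fin r)} (j : Fin r) :
    memFin c j = false ↔ j ∉ c := by
  rw [← Bool.not_eq_true, memFin_val]

theorem count_memFin {r : ℕ} {c : List (Fin r)} (hc : c.Nodup) :
    Nat.count (memFin c · = true) r = c.length := by
  rw [Nat.count_eq_card_filter_range, ← List.length_map (f := Fin.val) (as := c),
    ← List.toFinset_card_of_nodup (hc.map Fin.val_injective)]
  congr 1
  ext x
  simp only [Finset.mem_filter, Finset.mem_range, memFin, decide_eq_true_eq, List.mem_toFinset]
  refine ⟨And.right, fun h => ⟨?_, h⟩⟩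
  obtain ⟨i, -, rfl⟩ := List.mem_map.1 h
  exact i.2

theorem exists_length_eq_foldr_max {α : Type*} (L : List (List α))
    (h : (L.map List.length).foldr max 0 ≠ 0) :
    ∃ c ∈ L, c.length = (L.map List.length).foldr max 0 := by
  induction L with
  | nil => simp at h
  | cons c L ih =>
    rw [List.map_cons, List.foldr_cons] at h ⊢
    rcases le_total ((L.map List.length).foldr max 0) c.length with hle | hle
    · exact ⟨c, List.mem_cons_self, (max_eq_left hle).symm⟩
    · rw [max_eq_right hle] at h ⊢
      obtain ⟨c', hc', hl⟩ := ih h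
      exact ⟨c', List.mem_cons_of_mem _ hc', hl⟩

namespace ConjFormula

variable {r : ℕ} {φ : ConjFormula r}

/-- Incomparability is assumed along the order of the list; being a symmetric relation, it holds for
any two different clauses. -/
theorem Normalized.exists_mem_not_mem (h : φ.Normalized) {c c' : List (Fin r)}
    (hc : c ∈ φ.clauses) (hc' : c' ∈ φ.clauses) (hne : c' ≠ c) : ∃ i ∈ c', i ∉ c := by
  have : Std.Symm fun c c' : List (Fin r) => ¬ c ⊆ c' ∧ ¬ c' ⊆ c := ⟨fun _ _ h => h.symm⟩
  have := (h.incomparable.forall hc' hc hne).1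
  simpa [List.subset_def] using this

/-- A formula with a clause is consistent, by the field about the empty relation. -/
theorem Normalized.pin_unique (h : φ.Normalized) {c : List (Fin r)} (hc : c ∈ φ.clauses)
    {i : Fin r} (h0 : (i, false) ∈ φ.pins) : (i, true) ∉ φ.pins := fun h1 => by
  simp [h.consistent ⟨i, h0, h1⟩] at hc

/-- The values to which the arguments outside `c` are pinned: as in `φ`, and to `b` if `φ` does
not say. -/
def pinValue (φ : ConjFormula r) (c : List (Fin r)) (b : Bool) (j : ℕ) : Bool :=
  if memFin c j then !b
  else if j ∈ φ.pins.map fun p => (p.1 : ℕ) then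
    decide ((j, true) ∈ φ.pins.map fun p => ((p.1 : ℕ), p.2))
  else b

theorem pinValue_of_mem (c : List (Fin r)) (b : Bool) {j : ℕ} (h : memFin c j = true) :
    φ.pinValue c b j = !b := if_pos h

theorem Normalized.pinValue_of_pin (h : φ.Normalized) {c : List (Fin r)} (hc : c ∈ φ.clauses)
    (b : Bool) {p : Fin r × Bool} (hp : p ∈ φ.pins) : φ.pinValue c b p.1 = p.2 := by
  have h1 : ¬ memFin c p.1 = true := by
    rw [memFin_val]
    exact h.pinned_not_mem p hp c hc
  rw [pinValue, if_neg h1, if_pos (List.mem_map.2 ⟨p, hp, rfl⟩)]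
  obtain ⟨i, b'⟩ := p
  cases b' with
  | true => exact decide_eq_true (List.mem_map.2 ⟨_, hp, rfl⟩)
  | false =>
    refine decide_eq_false fun hm => ?_
    obtain ⟨⟨i', b'⟩, hp', he⟩ := List.mem_map.1 hm
    obtain ⟨hi, rfl⟩ := Prod.mk.inj he
    obtain rfl : i' = i := Fin.ext hi
    exact h.pin_unique hc hp hp'

/-- A variable in a clause is not pinned by a normalized formula, so the choice is free. -/
theorem Normalized.pinValue_of_not_mem (h : φ.Normalized) {c c' : List (Fin r)}
    (hc' : c' ∈ φ.clauses) (b : Bool) {j : Fin r} (hj : j ∉ c) (hj' : j ∈ c') :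
    φ.pinValue c b j = b := by
  have h1 : ¬ memFin c j = true := by rwa [memFin_val]
  rw [pinValue, if_neg h1, if_neg]
  intro hm
  obtain ⟨p, hp, he⟩ := List.mem_map.1 hm
  exact h.pinned_not_mem p hp c' hc' (Fin.ext he ▸ hj')

/-- Under the pins of the gadget, the formula is equivalent to a single one of its clauses. -/
theorem Normalized.forall_iff (h : φ.Normalized) {c : List (Fin r)} (hc : c ∈ φ.clauses)
    (b : Bool) {a : Fin r → Bool} (ha : ∀ j : Fin r, memFin c j = false → a j = φ.pinValue c b j) :
    ((∀ p ∈ φ.pins, a p.1 = p.2) ∧ ∀ c' ∈ φ.clauses, ∃ i ∈ c', a i = b) ↔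
      ∃ j : Fin r, memFin c j = true ∧ a j = b := by
  constructor
  · rintro ⟨-, h2⟩
    obtain ⟨i, hi, hai⟩ := h2 c hc
    exact ⟨i, (memFin_val i).2 hi, hai⟩
  · rintro ⟨j, hj, haj⟩
    refine ⟨fun p hp => ?_, fun c' hc' => ?_⟩
    · rw [ha _ ((memFin_val_eq_false _).2 (h.pinned_not_mem p hp c hc)), h.pinValue_of_pin hc b hp]
    -- Any clause other than `c` has an argument outside `c`, and there the gadget has put `b`.
    · by_cases hne : c' = c
      · exact ⟨j, by rwa [hne, ← memFin_val], haj⟩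
      · obtain ⟨i, hi, hic⟩ := h.exists_mem_not_mem hc hc' hne
        exact ⟨i, hi, by rw [ha i ((memFin_val_eq_false i).2 hic),
          h.pinValue_of_not_mem hc' b hic hi]⟩

end ConjFormula

/-- The slots are the arguments of a longest clause, which exists because `w ≠ 0`. ORs and NANDs are
treated alike: a NAND says that some argument is `false`. -/
theorem exists_isGadget {R : BoolRel} {w : ℕ} (hw : w ≠ 0)
    (hR : R.IsORConjOfWidth w ∨ R.IsNANDConjOfWidth w) :
    ∃ slot val g, IsGadget R slot val g ∧ Nat.count (slot · = true) R.arity = w := by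
  have key : ∀ (φ : ConjFormula R.arity) (b : Bool), φ.Normalized → φ.width = w →
      (∀ a, a ∈ R.rel ↔
        (∀ p ∈ φ.pins, a p.1 = p.2) ∧ ∀ c' ∈ φ.clauses, ∃ i ∈ c', a i = b) →
      ∃ slot val g, IsGadget R slot val g ∧ Nat.count (slot · = true) R.arity = w := by
    intro φ b hφ hwφ hrel
    obtain ⟨c, hc, hl⟩ := exists_length_eq_foldr_max φ.clauses (by rwa [← hwφ] at hw)
    exact ⟨memFin c, φ.pinValue c b, b,
      ⟨fun j hj => φ.pinValue_of_mem c b hj, fun a ha => (hrel a).trans (hφ.forall_iff hc b ha)⟩,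
      (count_memFin (hφ.nodup c hc)).trans (hl.trans hwφ)⟩
  rcases hR with ⟨φ, hφ, hrel, hwφ⟩ | ⟨φ, hφ, hrel, hwφ⟩
  · exact key φ true hφ hwφ hrel
  · refine key φ false hφ hwφ fun a => (hrel a).trans ?_
    simp [ConjFormula.HoldsNAND]

/-! ### The CSP instance of a hypergraph -/

section gadgetInstance

variable (R : BoolRel) (slot val : ℕ → Bool) {n : ℕ} (L : List (Finset (Fin n)))

/-- The pin of `v` to `b`. -/
def pinConstraint {V : Type} (b : Bool) (v : V) : Constraint ([R] ++ pinLanguage) V :=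
  ⟨⟨pinName b, by cases b <;> simp [pinName, pinLanguage]⟩, fun _ => v⟩

/-- The constraint `R(x₁, …, x_r)`. -/
def relConstraint {V : Type} (x : Fin R.arity → V) : Constraint ([R] ++ pinLanguage) V :=
  ⟨⟨0, by simp⟩, x⟩

theorem constraintCode_pinConstraint {N : ℕ} (b : Bool) (v : Fin N) :
    constraintCode (pinConstraint R b v) = unary (pinName b) ++ unary v := by
  cases b <;> exact congrArg _ (List.append_nil _)

theorem constraintCode_relConstraint {N : ℕ} (x : Fin R.arity → Fin N) :
    constraintCode (relConstraint R x) =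
      unary 0 ++ (List.ofFn fun j => (x j : ℕ)).flatMap unary := rfl

/-- Comparing codes avoids an equality between scopes whose types depend on `b` and `b'`. -/
theorem pinConstraint_injective {N : ℕ} {b b' : Bool} {v v' : Fin N}
    (h : pinConstraint R b v = pinConstraint R b' v') : v = v' := by
  have h' := congrArg constraintCode h
  rw [constraintCode_pinConstraint, constraintCode_pinConstraint] at h'
  have h'' := (unary_append_inj h').2
  rw [← List.append_nil (unary v), ← List.append_nil (unary v')] at h''
  exact Fin.ext (unary_append_inj h'').1

theorem relConstraint_injective {V : Type} {x x' : Fin R.arity → V}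
    (h : relConstraint R x = relConstraint R x') : x = x' :=
  eq_of_heq (Sigma.mk.inj h).2

theorem relConstraint_ne_pinConstraint {V : Type} (x : Fin R.arity → V) (b : Bool) (v : V) :
    relConstraint R x ≠ pinConstraint R b v := fun h => by
  have : (0 : ℕ) = pinName b := congrArg (fun c => (c.1 : ℕ)) h
  cases b <;> simp [pinName] at this

theorem pinConstraint_satisfied {V : Type} (b : Bool) (v : V) (σ : V → Bool) :
    (fun j => σ ((pinConstraint R b v).2 j)) ∈
      (([R] ++ pinLanguage).get (pinConstraint R b v).1).rel ↔ σ v = b := by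
  cases b <;> exact Iff.rfl

theorem card_pinConstraint {V : Type} [DecidableEq V] (b : Bool) (v i : V) :
    (Finset.univ.filter fun j => (pinConstraint R b v).2 j = i).card = if v = i then 1 else 0 := by
  by_cases h : v = i
  · rw [if_pos h, Finset.filter_true_of_mem (p := fun j => (pinConstraint R b v).2 j = i)
      fun _ _ => h]
    cases b <;> rfl
  · rw [if_neg h, Finset.filter_false_of_mem (p := fun j => (pinConstraint R b v).2 j = i)
      fun _ _ => h, Finset.card_empty]

/-- The number of variables. -/
abbrev gadgetVars : ℕ := n + L.length * R.arity

/-- The fresh variable for an argument of the gadget of a hyper-edge. -/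
def freshVar (k : Fin L.length) (j : Fin R.arity) : Fin (gadgetVars R L) :=
  ⟨n + k * R.arity + j, by
    have : (k + 1 : ℕ) * R.arity ≤ L.length * R.arity := Nat.mul_le_mul_right _ k.2
    rw [add_one_mul] at this
    have := j.2
    unfold gadgetVars
    omega⟩

/-- The variable of a vertex. -/
def vertexVar (v : Fin n) : Fin (gadgetVars R L) := Fin.castLE (Nat.le_add_right _ _) v

/-- The arguments of the gadget of a hyper-edge. -/
def gadgetScope (k : Fin L.length) (j : Fin R.arity) : Fin (gadgetVars R L) :=
  ⟨fillSlots slot (n + k * R.arity) R.arity (edgeList (L.get k)) j, by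
    rcases fillSlots_mem_or slot (n + k * R.arity) j R.arity (edgeList (L.get k)) with h | h
    · exact (lt_of_mem_edgeList h).trans_le (Nat.le_add_right _ _)
    · rw [h]
      exact (freshVar R L k j).2⟩

/-- The constraints: one `R` for each hyper-edge, and the pins of its fresh variables. -/
def gadgetConstraint : Fin L.length ⊕ Fin L.length × Fin R.arity →
    Constraint ([R] ++ pinLanguage) (Fin (gadgetVars R L))
  | Sum.inl k => relConstraint R (gadgetScope R slot L k)
  | Sum.inr (k, j) => pinConstraint R (val j) (freshVar R L k j)

/-- The CSP instance of a hypergraph with hyper-edges `L`. -/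
def gadgetInstance : CSPInstance ([R] ++ pinLanguage) (Fin (gadgetVars R L)) :=
  ⟨Finset.univ.image (gadgetConstraint R slot val L)⟩

/-- The order in which the constraints are written. -/
def gadgetOrder (m r : ℕ) : List (Fin m ⊕ Fin m × Fin r) :=
  (List.finRange m).reverse.flatMap fun k =>
    Sum.inl k :: (List.finRange r).reverse.map fun j => Sum.inr (k, j)

theorem nodup_gadgetOrder (m r : ℕ) : (gadgetOrder m r).Nodup := by
  rw [gadgetOrder, List.nodup_flatMap]
  constructor
  · intro k _
    rw [List.nodup_cons]
    refine ⟨by simp, (List.nodup_reverse.2 (List.nodup_finRange r)).map fun a b h => ?_⟩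
    simpa using h
  · refine (List.nodup_reverse.2 (List.nodup_finRange m)).imp fun {k k'} hk => ?_
    rw [Function.onFun, List.disjoint_left]
    rintro (i | ⟨i, j⟩) h h'
    · exact hk ((by simpa using h : i = k).symm.trans (by simpa using h'))
    · exact hk ((by simpa using h : k = i).trans (by simpa using Eq.symm (by simpa using h')))

theorem mem_gadgetOrder {m r : ℕ} (i : Fin m ⊕ Fin m × Fin r) : i ∈ gadgetOrder m r := by
  rcases i with k | ⟨k, j⟩ <;> simp [gadgetOrder]

variable {R L}

/-- Division with remainder by the arity recovers `k` and `j`. -/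
theorem freshVar_injective {k k' : Fin L.length} {j j' : Fin R.arity}
    (h : freshVar R L k j = freshVar R L k' j') : (k, j) = (k', j') := by
  have hv : n + (k : ℕ) * R.arity + j = n + (k' : ℕ) * R.arity + j' := congrArg Fin.val h
  have hr : 0 < R.arity := j.pos
  have h1 : (j + R.arity * k : ℕ) = j' + R.arity * k' := by
    rw [mul_comm _ (k : ℕ), mul_comm _ (k' : ℕ)]
    omega
  have h2 := congrArg (· % R.arity) h1
  have h3 := congrArg (· / R.arity) h1
  simp only [Nat.add_mul_mod_self_left, Nat.mod_eq_of_lt j.2, Nat.mod_eq_of_lt j'.2] at h2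
  simp only [Nat.add_mul_div_left _ _ hr, Nat.div_eq_of_lt j.2, Nat.div_eq_of_lt j'.2,
    zero_add] at h3
  exact Prod.ext (Fin.ext h3) (Fin.ext h2)

theorem vertexVar_ne_freshVar (v : Fin n) (k : Fin L.length) (j : Fin R.arity) :
    vertexVar R L v ≠ freshVar R L k j := fun h => by
  have : (v : ℕ) = n + k * R.arity + j := congrArg Fin.val h
  omega

theorem exists_eq_vertexVar_or_freshVar (i : Fin (gadgetVars R L)) :
    (∃ v, i = vertexVar R L v) ∨ ∃ k j, i = freshVar R L k j := by
  rcases lt_or_ge (i : ℕ) n with h | h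
  · exact Or.inl ⟨⟨i, h⟩, rfl⟩
  · right
    obtain ⟨d, hd⟩ := Nat.exists_eq_add_of_le h
    have hlt : d < L.length * R.arity := by
      have := i.2
      unfold gadgetVars at this
      omega
    have hr : 0 < R.arity := Nat.pos_of_ne_zero fun h0 => by simp [h0] at hlt
    refine ⟨⟨d / R.arity, (Nat.div_lt_iff_lt_mul hr).2 hlt⟩, ⟨d % R.arity, Nat.mod_lt _ hr⟩,
      Fin.ext ?_⟩
    change (i : ℕ) = n + d / R.arity * R.arity + d % R.arity
    rw [add_assoc, Nat.div_add_mod', hd]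

theorem gadgetScope_of_not_slot {j : Fin R.arity} (h : slot j = false) (k : Fin L.length) :
    gadgetScope R slot L k j = freshVar R L k j :=
  Fin.ext (fillSlots_of_not_slot slot _ h _ _)

theorem gadgetScope_eq_or (k : Fin L.length) (j : Fin R.arity) :
    (∃ v ∈ L.get k, gadgetScope R slot L k j = vertexVar R L v) ∨
      gadgetScope R slot L k j = freshVar R L k j := by
  rcases fillSlots_mem_or slot (n + k * R.arity) j R.arity (edgeList (L.get k)) with h | h
  · obtain ⟨v, hv, hvx⟩ := mem_edgeList.1 h
    exact Or.inl ⟨v, hv, Fin.ext hvx.symm⟩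
  · exact Or.inr (Fin.ext h)

theorem gadgetScope_injective (k : Fin L.length) :
    Function.Injective (gadgetScope R slot L k) := fun _ _ h =>
  Fin.ext (fillSlots_injective slot _ _ _ (nodup_edgeList _)
    (fun _ hx => (lt_of_mem_edgeList hx).trans_le (Nat.le_add_right _ _)) (congrArg Fin.val h))

theorem exists_gadgetScope_eq {k : Fin L.length}
    (hk : (L.get k).card ≤ Nat.count (slot · = true) R.arity) {v : Fin n} (hv : v ∈ L.get k) :
    ∃ j : Fin R.arity, slot j = true ∧ gadgetScope R slot L k j = vertexVar R L v := by
  rw [← length_edgeList] at hk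
  obtain ⟨j, hj, hs, hf⟩ := exists_fillSlots_eq slot (n + k * R.arity) R.arity _ hk
    (mem_edgeList.2 ⟨v, hv, rfl⟩)
  exact ⟨⟨j, hj⟩, hs, Fin.ext hf⟩

theorem vertexVar_injective : Function.Injective (vertexVar R L) :=
  Fin.castLE_injective (Nat.le_add_right _ _)

/-- The hyper-edge can be read off the scope of its gadget. -/
theorem mem_iff_exists_gadgetScope {k : Fin L.length}
    (hk : (L.get k).card ≤ Nat.count (slot · = true) R.arity) (v : Fin n) :
    v ∈ L.get k ↔ ∃ j, gadgetScope R slot L k j = vertexVar R L v := by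
  refine ⟨fun hv => (exists_gadgetScope_eq slot hk hv).imp fun _ => And.right, ?_⟩
  rintro ⟨j, hj⟩
  rcases gadgetScope_eq_or slot k j with ⟨v', hv', h⟩ | h
  · rwa [vertexVar_injective (hj.symm.trans h)]
  · exact absurd (hj.symm.trans h) (vertexVar_ne_freshVar v k j)

/-- An instance is a set of constraints and its encoding lists each once, so coincidences would
spoil the written list. Scopes determine their hyper-edges, and pins their fresh variables. -/
theorem gadgetConstraint_injective (hL : L.Nodup)
    (hk : ∀ e ∈ L, e.card ≤ Nat.count (slot · = true) R.arity) :
    Function.Injective (gadgetConstraint R slot val L) := by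
  rintro (k | ⟨k, j⟩) (k' | ⟨k', j'⟩) h
  · have hs := relConstraint_injective R h
    have : L.get k = L.get k' := by
      ext v
      rw [mem_iff_exists_gadgetScope slot (hk _ (List.get_mem _ _)),
        mem_iff_exists_gadgetScope slot (hk _ (List.get_mem _ _)), hs]
    rw [List.nodup_iff_injective_get.1 hL this]
  · exact absurd h (relConstraint_ne_pinConstraint R _ _ _)
  · exact absurd h.symm (relConstraint_ne_pinConstraint R _ _ _)
  · rw [freshVar_injective (pinConstraint_injective R h)]

/-! ### The encoding of the instance -/

theorem pinsCode_eq (f r : ℕ) : pinsCode val f r =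
    (List.finRange r).reverse.flatMap fun j : Fin r =>
      unary (pinName (val j)) ++ unary (f + j) := by
  have : pinsCode val f r =
      (List.range r).reverse.flatMap fun j => unary (pinName (val j)) ++ unary (f + j) := by
    induction r with
    | zero => rfl
    | succ r ih =>
      rw [List.range_succ, List.reverse_append, List.reverse_singleton, List.singleton_append,
        List.flatMap_cons, ← ih]
      rfl
  rw [this, ← List.map_coe_finRange_eq_range, ← List.map_reverse, List.flatMap_map]

/-- Later rows are pushed further to the left, hence the reversal. -/
theorem gadgetsCode_eq (r : ℕ) {α : Type*} (row : α → List Bool) (M : List α) :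
    ∀ (f : ℕ) (q : List Bool), gadgetsCode r slot val f (M.map row) q =
      (List.ofFn fun k : Fin M.length =>
        gadgetCode r slot val (f + k * r) (onesFrom 0 (row (M.get k)))).reverse.flatten ++ q := by
  induction M with
  | nil => intro f q; rfl
  | cons a M ih =>
    intro f q
    have hf : ∀ k : ℕ, f + (k + 1) * r = f + r + k * r := fun k => by ring
    rw [List.map_cons, gadgetsCode, ih]
    simp [List.ofFn_succ, hf]

theorem gadgetCode_eq (k : Fin L.length) :
    gadgetCode R.arity slot val (n + k * R.arity) (edgeList (L.get k)) =
      (gadgetConstraint R slot val L (Sum.inl k) ::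
        (List.finRange R.arity).reverse.map fun j =>
          gadgetConstraint R slot val L (Sum.inr (k, j))).flatMap constraintCode := by
  rw [gadgetCode, List.flatMap_cons, pinsCode_eq, List.flatMap_map]
  simp only [gadgetConstraint, constraintCode_pinConstraint]
  rw [constraintCode_relConstraint, List.ofFn_eq_map, List.flatMap_map,
    ← List.map_coe_finRange_eq_range, List.flatMap_map]
  rfl

theorem gadgetsCode_eq_flatMap :
    gadgetsCode R.arity slot val n (L.map edgeRow) [] =
      ((gadgetOrder L.length R.arity).map (gadgetConstraint R slot val L)).flatMap
        constraintCode := by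
  rw [gadgetsCode_eq, List.append_nil, List.ofFn_eq_map, ← List.map_reverse, ← List.flatMap_def,
    gadgetOrder, List.map_flatMap, List.flatMap_assoc]
  congr 1
  funext k
  rw [← edgeList, gadgetCode_eq, List.map_cons, List.map_map]
  rfl

theorem gadgetInstance_encodedBy (hL : L.Nodup)
    (hk : ∀ e ∈ L, e.card ≤ Nat.count (slot · = true) R.arity) :
    (gadgetInstance R slot val L).EncodedBy
      (unary (gadgetVars R L) ++ gadgetsCode R.arity slot val n (L.map edgeRow) []) := by
  refine ⟨(gadgetOrder L.length R.arity).map (gadgetConstraint R slot val L),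
    (nodup_gadgetOrder _ _).map (gadgetConstraint_injective slot val hL hk), ?_, ?_⟩
  · ext c
    simp [gadgetInstance, mem_gadgetOrder]
  · rw [cspCode, gadgetsCode_eq_flatMap]

/-! ### Degree and solutions of the instance -/

theorem gadgetInstance_occurrences (hL : L.Nodup)
    (hk : ∀ e ∈ L, e.card ≤ Nat.count (slot · = true) R.arity) (i : Fin (gadgetVars R L)) :
    (gadgetInstance R slot val L).occurrences i =
      ∑ k, (Finset.univ.filter fun j => gadgetScope R slot L k j = i).card +
        (Finset.univ.filter fun p : Fin L.length × Fin R.arity =>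
          freshVar R L p.1 p.2 = i).card := by
  rw [CSPInstance.occurrences, gadgetInstance,
    Finset.sum_image (gadgetConstraint_injective slot val hL hk).injOn, Fintype.sum_sum_type,
    Finset.card_filter]
  congr 1
  exact Finset.sum_congr rfl fun p _ => card_pinConstraint R _ _ _

/-- A vertex is never pinned, and occurs exactly in the scopes of its hyper-edges, once in each by
injectivity. A fresh variable occurs in one pin and at most once in a scope. -/
theorem gadgetInstance_degree_le {d : ℕ} (hd : 2 ≤ d) (hL : L.Nodup)
    (hk : ∀ e ∈ L, e.card ≤ Nat.count (slot · = true) R.arity)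
    (hdeg : ∀ v, (L.toFinset.filter fun e => v ∈ e).card ≤ d) :
    (gadgetInstance R slot val L).degree ≤ d := by
  refine Finset.sup_le fun i _ => ?_
  rw [gadgetInstance_occurrences slot val hL hk]
  rcases exists_eq_vertexVar_or_freshVar i with ⟨v, rfl⟩ | ⟨k₀, j₀, rfl⟩
  · have h0 : (Finset.univ.filter fun p : Fin L.length × Fin R.arity =>
        freshVar R L p.1 p.2 = vertexVar R L v) = ∅ :=
      Finset.filter_false_of_mem fun p _ h => vertexVar_ne_freshVar v p.1 p.2 h.symm
    rw [h0, Finset.card_empty, add_zero]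
    refine le_trans ?_ (hdeg v)
    calc ∑ k, (Finset.univ.filter fun j => gadgetScope R slot L k j = vertexVar R L v).card
        ≤ ∑ k : Fin L.length, if v ∈ L.get k then 1 else 0 := by
          refine Finset.sum_le_sum fun k _ => ?_
          split
          case isTrue h =>
            refine Finset.card_le_one.2 fun a ha b hb => gadgetScope_injective slot k ?_
            rw [(Finset.mem_filter.1 ha).2, (Finset.mem_filter.1 hb).2]
          case isFalse h =>
            rw [Finset.filter_false_of_mem, Finset.card_empty]
            exact fun j _ hj => h
              ((mem_iff_exists_gadgetScope slot (hk _ (List.get_mem _ _)) v).2 ⟨j, hj⟩)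
      _ = (Finset.univ.filter fun k : Fin L.length => v ∈ L.get k).card :=
          (Finset.card_filter _ _).symm
      _ ≤ (L.toFinset.filter fun e => v ∈ e).card := by
          refine Finset.card_le_card_of_injOn L.get (fun k hk => ?_)
            (List.nodup_iff_injective_get.1 hL).injOn
          simpa using hk
  · refine le_trans ?_ hd
    have h1 : (Finset.univ.filter fun p : Fin L.length × Fin R.arity =>
        freshVar R L p.1 p.2 = freshVar R L k₀ j₀).card ≤ 1 :=
      Finset.card_le_one.2 fun a ha b hb =>
        freshVar_injective ((Finset.mem_filter.1 ha).2.trans (Finset.mem_filter.1 hb).2.symm)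
    -- Argument `j` of gadget `k` holds either a vertex or its own fresh variable, so a fresh
    -- variable can occur only at its own place.
    have h2 : ∑ k, (Finset.univ.filter fun j =>
        gadgetScope R slot L k j = freshVar R L k₀ j₀).card ≤
        (Finset.univ.filter fun p : Fin L.length × Fin R.arity =>
          freshVar R L p.1 p.2 = freshVar R L k₀ j₀).card := by
      rw [Finset.card_filter, Fintype.sum_prod_type]
      refine Finset.sum_le_sum fun k _ => ?_
      rw [← Finset.card_filter]
      refine Finset.card_le_card fun j hj => ?_
      rw [Finset.mem_filter] at hj ⊢
      refine ⟨hj.1, ?_⟩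
      rcases gadgetScope_eq_or slot k j with ⟨v, -, h⟩ | h
      · exact absurd (h.symm.trans hj.2) (vertexVar_ne_freshVar v k₀ j₀)
      · exact h.symm.trans hj.2
    omega

/-- `IsGadget` is only assumed in the presence of a hyper-edge, so that the case of width `0` is
included. -/
theorem gadgetInstance_satisfies {g : Bool}
    (hk : ∀ e ∈ L, e.card ≤ Nat.count (slot · = true) R.arity ∧ IsGadget R slot val g)
    (σ : Fin (gadgetVars R L) → Bool) :
    (gadgetInstance R slot val L).Satisfies σ ↔
      (∀ k j, σ (freshVar R L k j) = val j) ∧ ∀ e ∈ L, ∃ v ∈ e, σ (vertexVar R L v) = g := by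
  have h1 : (gadgetInstance R slot val L).Satisfies σ ↔
      (∀ k j, σ (freshVar R L k j) = val j) ∧
        ∀ k, (fun j => σ (gadgetScope R slot L k j)) ∈ R.rel := by
    simp only [CSPInstance.Satisfies, gadgetInstance, Finset.mem_image, Finset.mem_univ, true_and,
      forall_exists_index, Sum.forall, Prod.forall]
    rw [and_comm]
    refine ⟨fun h => ⟨fun k => (h _).1 k rfl, fun k j => ?_⟩, fun h c => ⟨?_, ?_⟩⟩
    · exact (pinConstraint_satisfied R _ _ σ).1 ((h _).2 k j rfl)
    · rintro k rfl
      exact h.1 k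
    · rintro k j rfl
      exact (pinConstraint_satisfied R _ _ σ).2 (h.2 k j)
  rw [h1, and_congr_right_iff]
  intro hf
  rw [List.forall_mem_iff_get]
  refine forall_congr' fun k => ?_
  obtain ⟨hcard, hg⟩ := hk _ (List.get_mem L k)
  rw [hg.mem_rel _ fun j hj => by rw [gadgetScope_of_not_slot slot hj, hf]]
  constructor
  · rintro ⟨j, hj, hσ⟩
    rcases gadgetScope_eq_or slot k j with ⟨v, hv, h⟩ | h
    · exact ⟨v, hv, h ▸ hσ⟩
    -- A slot holding its own fresh variable has the value `!g`, so it cannot be the witness.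
    · rw [h, hf, hg.val_slot j hj] at hσ
      simp at hσ
  · rintro ⟨v, hv, hσ⟩
    obtain ⟨j, hj, h⟩ := exists_gadgetScope_eq slot hcard hv
    exact ⟨j, hj, h ▸ hσ⟩

/-- The assignment that corresponds to a set of vertices. -/
def gadgetAssignment (R : BoolRel) (val : ℕ → Bool) (g : Bool) (L : List (Finset (Fin n)))
    (S : Finset (Fin n)) (i : Fin (gadgetVars R L)) : Bool :=
  if h : (i : ℕ) < n then (if ⟨i, h⟩ ∈ S then !g else g) else val ((i - n) % R.arity)

theorem gadgetAssignment_vertexVar (g : Bool) (S : Finset (Fin n)) (v : Fin n) :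
    gadgetAssignment R val g L S (vertexVar R L v) = if v ∈ S then !g else g :=
  dif_pos v.2

theorem gadgetAssignment_freshVar (g : Bool) (S : Finset (Fin n)) (k : Fin L.length)
    (j : Fin R.arity) : gadgetAssignment R val g L S (freshVar R L k j) = val j := by
  have h : ¬ n + (k : ℕ) * R.arity + j < n := by omega
  refine (dif_neg h).trans (congrArg val ?_)
  change (n + k * R.arity + j - n) % R.arity = j
  rw [add_assoc, Nat.add_sub_cancel_left, Nat.mul_add_mod_self_right, Nat.mod_eq_of_lt j.2]

/-- The reduction is parsimonious. -/
theorem card_satisfies_gadgetInstance {g : Bool} (H : FinHypergraph (Fin n))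
    (hH : L.toFinset = H.edges)
    (hk : ∀ e ∈ L, e.card ≤ Nat.count (slot · = true) R.arity ∧ IsGadget R slot val g) :
    Nat.card {σ // (gadgetInstance R slot val L).Satisfies σ} =
      Nat.card {S : Finset (Fin n) // H.IsIndependent S} := by
  have hbool : ∀ (S : Finset (Fin n)) (v : Fin n),
      gadgetAssignment R val g L S (vertexVar R L v) = g ↔ v ∉ S := by
    intro S v
    rw [gadgetAssignment_vertexVar]
    by_cases h : v ∈ S <;> simp [h]
  have hsat : ∀ S, (gadgetInstance R slot val L).Satisfies (gadgetAssignment R val g L S) ↔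
      H.IsIndependent S := by
    intro S
    rw [gadgetInstance_satisfies slot val hk]
    simp only [gadgetAssignment_freshVar, implies_true, true_and, hbool,
      FinHypergraph.IsIndependent, ← hH, List.mem_toFinset, Finset.not_subset]
  refine (Nat.card_eq_of_bijective
    (fun S : {S : Finset (Fin n) // H.IsIndependent S} =>
      (⟨gadgetAssignment R val g L S, (hsat S).2 S.2⟩ :
        {σ // (gadgetInstance R slot val L).Satisfies σ})) ⟨?_, ?_⟩).symm
  · intro S S' h
    ext v
    have h' := congrFun (congrArg Subtype.val h) (vertexVar R L v)
    rw [← not_iff_not, ← hbool S, ← hbool S']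
    exact iff_of_eq (congrArg (· = g) h')
  · rintro ⟨σ, hσ⟩
    have hfresh := ((gadgetInstance_satisfies slot val hk σ).1 hσ).1
    have heq : gadgetAssignment R val g L
        (Finset.univ.filter fun v => σ (vertexVar R L v) ≠ g) = σ := by
      funext i
      rcases exists_eq_vertexVar_or_freshVar i with ⟨v, rfl⟩ | ⟨k, j, rfl⟩
      · rw [gadgetAssignment_vertexVar]
        by_cases h : σ (vertexVar R L v) = g
        · simp [h]
        · simp [Bool.eq_not_of_ne h]
      · rw [gadgetAssignment_freshVar, hfresh]
    exact ⟨⟨_, (hsat _).1 (heq.symm ▸ hσ)⟩, Subtype.ext heq⟩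

end gadgetInstance

/-! ### The reduction assembled -/

theorem hypergraphCode_eq {n : ℕ} (L : List (Finset (Fin n))) :
    hypergraphCode n L = unary n ++ (L.map edgeRow).flatMap (List.cons true) := by
  rw [hypergraphCode, List.flatMap_map]
  rfl

theorem length_add_le_length_hypergraphCode {n : ℕ} (L : List (Finset (Fin n))) :
    n + L.length ≤ (hypergraphCode n L).length := by
  have h : ∀ M : List (Finset (Fin n)), M.length ≤ (M.flatMap edgeCode).length := by
    intro M
    induction M with
    | nil => simp
    | cons e M ih =>
      rw [List.flatMap_cons, List.length_append, List.length_cons]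
      simp only [edgeCode, List.length_cons]
      omega
  have := h L
  rw [hypergraphCode, List.length_append, unary, List.length_append, List.length_replicate]
  omega

/-- If every hyper-edge fits into a gadget of `R`, then counting independent sets reduces to
counting solutions. -/
theorem apReducible_of_isGadget {R : BoolRel} {w d : ℕ} (hd : 2 ≤ d) {slot val : ℕ → Bool}
    {g : Bool} (hg : w ≠ 0 → IsGadget R slot val g ∧ Nat.count (slot · = true) R.arity = w) :
    APReducible (countHIS w d) (countCSP d ([R] ++ pinLanguage)) := by
  refine apReducible_of_computes (TapeProgram.reduction R.arity slot val)
    -- The bound of `computes_reduction`, with the number of vertices plus hyper-edges replaced by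
    -- the length of the input, which is at least as large.
    ((Polynomial.X + 1) * (Polynomial.C (R.arity + 1) *
      (Polynomial.C 10 * (Polynomial.C (R.arity + 1) * Polynomial.X) + Polynomial.C 30))) ?_
  rintro x ⟨⟨n, H⟩, hw, hdeg⟩ ⟨L, hL, hLH, rfl⟩
  dsimp only at L hL hLH hw hdeg
  have hcard : ∀ e ∈ L, e.card ≤ w := fun e he =>
    hw ▸ Finset.le_sup (f := Finset.card) (hLH ▸ List.mem_toFinset.2 he)
  have hw0 : ∀ e ∈ L, w ≠ 0 := fun e he h0 => by
    have := Finset.card_pos.2 (H.nonempty e (hLH ▸ List.mem_toFinset.2 he))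
    have := hcard e he
    omega
  have hk : ∀ e ∈ L, e.card ≤ Nat.count (slot · = true) R.arity ∧ IsGadget R slot val g :=
    fun e he => by
      obtain ⟨h1, h2⟩ := hg (hw0 e he)
      exact ⟨h2 ▸ hcard e he, h1⟩
  have hk' := fun e he => (hk e he).1
  refine ⟨unary (gadgetVars R L) ++ gadgetsCode R.arity slot val n (L.map edgeRow) [],
    ⟨⟨gadgetVars R L, gadgetInstance R slot val L⟩,
      gadgetInstance_degree_le slot val hd hL hk' fun v => ?_⟩,
    gadgetInstance_encodedBy slot val hL hk', card_satisfies_gadgetInstance slot val H hLH hk,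
    fun e => ?_⟩
  · rw [hLH]
    exact (Finset.le_sup (f := H.vertexDegree) (Finset.mem_univ v)).trans hdeg
  · obtain ⟨T, hT, h2, h1⟩ := TapeProgram.computes_reduction R.arity slot val e n (L.map edgeRow)
      (by simp [edgeRow])
    rw [← hypergraphCode_eq, List.length_map] at hT
    rw [List.length_map] at h2
    refine ⟨T, hT.mono ?_, h2, h1⟩
    have := length_add_le_length_hypergraphCode L
    simp only [Polynomial.eval_mul, Polynomial.eval_add, Polynomial.eval_X, Polynomial.eval_one,
      Polynomial.eval_C]
    gcongr

theorem proposition6p2 (R : BoolRel) (w d : ℕ) (hd : 2 ≤ d)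
    (hR : R.IsORConjOfWidth w ∨ R.IsNANDConjOfWidth w) :
    APReducible (countHIS w d) (countCSP d ([R] ++ pinLanguage)) := by
  by_cases hw : w = 0
  -- Without hyper-edges no gadget is ever written, so the parameters are arbitrary.
  · exact apReducible_of_isGadget (slot := fun _ => false) (val := fun _ => false) (g := false) hd
      fun h => absurd hw h
  · obtain ⟨slot, val, g, hg⟩ := exists_isGadget hw hR
    exact apReducible_of_isGadget hd fun _ => hg
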